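/- Graphs are finite, simple and undirected. For a connected graph $G$ with a vertex $v$, let $m_G$ be its number of edges, $\tau_G$ its number of spanning trees, $\mathbf d_G$ its degree vector, and $F_G=[f_{i,j}]$ the matrix in which $f_{i,j}$ is the number of spanning forests of $G$ that consist of exactly two trees, one containing $i$ and the other containing $j$ (so $f_{i,i}=0$). Let $\mathbf f_G^v$ be the $v$-th column of $F_G$, let $\mathbf 1$ be the all-ones vector, and put $$\phi_G(v)=\mathbf d_G^T\left(2\,\mathbf f_G^v\mathbf 1^T-F_G\right)\mathbf d_G .$$ For a connected graph $H$ with at least two vertices, let $\kappa(H)$ be Kemeny's constant of the simple random walk on $H$, that is, $\kappa(H)=\sum_{j\ne i}m_{i,j}w_j$ (independent of the state $i$), where $m_{i,j}$ is the mean first passage time from $i$ to $j$ and $w$ is the stationary distribution. For integers $k_1,k_2\ge 0$ with $k_1+k_2\ge 2$, let $\widetilde G(v,k_1,k_2)$ be the graph obtained from $G$ and two paths $(v_1,\dots,v_{k_1+1})$ and $(w_1,\dots,w_{k_2+1})$ by identifying $v$, $v_1$ and $w_1$, and let $\widehat G(v,k_1,k_2)$ be obtained from $\widetilde G(v,k_1,k_2)$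 by inserting the edge $v_{k_1+1}\sim w_{k_2+1}$. The graph $G$ is called $(v,k_1,k_2)$-paradoxical if $\kappa(\widehat G(v,k_1,k_2))>\kappa(\widetilde G(v,k_1,k_2))$. **Theorem.** Let $G_1,G_2,\dots$ be a sequence of graphs in which, for each $n\ge 1$, $G_n$ is a connected graph of order $n$ with a specified vertex $v=v_n$. The sequence is called asymptotically paradoxical if for all integers $k_1,k_2\ge 0$ with $k_1+k_2\ge 2$ there exists $N>0$ such that $G_n$ is $(v,k_1,k_2)$-paradoxical for all $n\ge N$. Then the sequence is asymptotically paradoxical if and only if $$\frac{\phi_{G_n}(v)}{4m_{G_n}^2\tau_{G_n}}\longrightarrow\infty\qquad\text{as } n\to\infty .$$ -/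

import Mathlib

open Filter

noncomputable section

namespace TwinPaths

/-! ### Kemeny's constant of a finite Markov chain -/

section MarkovChain

variable {V : Type*} [Fintype V]

open Classical in
/-- `firstPassageProb M j t i` is the probability that the chain with transition matrix `M`,
started at state `i`, visits `j` at time `t` for the first time after time `0`. -/
def firstPassageProb (M : Matrix V V ℝ) (j : V) : ℕ → V → ℝ
  | 0, _ => 0
  | 1, i => M i j
  | t + 2, i => ∑ l : V with l ≠ j, M i l * firstPassageProb M j (t + 1) l

/-- `μ` is the mean first passage time from `i` to `j`: the state `j` is reached almost surely,
and the first passage time has (finite) expectation `μ`. -/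
def IsMeanFirstPassageTime (M : Matrix V V ℝ) (i j : V) (μ : ℝ) : Prop :=
  HasSum (fun t : ℕ => firstPassageProb M j t i) 1 ∧
    HasSum (fun t : ℕ => (t : ℝ) * firstPassageProb M j t i) μ

/-- `w` is a stationary distribution of the chain with transition matrix `M`. -/
def IsStationaryDistribution (M : Matrix V V ℝ) (w : V → ℝ) : Prop :=
  (∀ i, 0 ≤ w i) ∧ ∑ i, w i = 1 ∧ Matrix.vecMul w M = w

open Classical in
/-- `K` is Kemeny's constant of the chain with transition matrix `M`: the number
`∑_{j ≠ i} m_{i,j} w_j`, the same for every state `i`, where `m_{i,j}` are the mean first passage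
times and `w` is the stationary distribution. -/
def IsKemenyConstant (M : Matrix V V ℝ) (K : ℝ) : Prop :=
  ∃ (m : V → V → ℝ) (w : V → ℝ),
    (∀ i j, IsMeanFirstPassageTime M i j (m i j)) ∧
    IsStationaryDistribution M w ∧
    ∀ i, ∑ j : V with j ≠ i, m i j * w j = K

end MarkovChain

/-! ### Graphs: degrees, random walk, spanning trees and 2-tree spanning forests -/

section Graph

variable {V : Type*} [Fintype V]

open Classical in
/-- The degree vector of `G`. -/
def degVec (G : SimpleGraph V) : V → ℝ := fun i => (G.degree i : ℝ)

open Classical in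
/-- The number of edges of `G`. -/
def numEdges (G : SimpleGraph V) : ℕ := G.edgeFinset.card

open Classical in
/-- The transition matrix of the simple random walk on `G`. -/
def walkMatrix (G : SimpleGraph V) : Matrix V V ℝ :=
  Matrix.of fun i j => if G.Adj i j then 1 / degVec G i else 0

/-- The number of spanning trees of `G`. -/
def numSpanningTrees (G : SimpleGraph V) : ℕ :=
  {T : SimpleGraph V | T ≤ G ∧ T.IsTree}.ncard

/-- The 2-tree spanning forests of `G` with `i` in one of the two trees and `j` in the other. -/
def twoForests (G : SimpleGraph V) (i j : V) : Set (SimpleGraph V) :=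
  {T : SimpleGraph V | T ≤ G ∧ T.IsAcyclic ∧ Nat.card T.ConnectedComponent = 2 ∧
    ¬ T.Reachable i j}

/-- The matrix `F_G`, whose `(i,j)` entry is the number of 2-tree spanning forests of `G`
separating `i` from `j`. -/
def forestMatrix (G : SimpleGraph V) : Matrix V V ℝ :=
  Matrix.of fun i j => ((twoForests G i j).ncard : ℝ)

/-- `φ_G(v) = dᵀ (2 f^v 1ᵀ - F) d`, where `f^v` is the `v`-th column of `F = F_G` and `d` is the
degree vector of `G`. -/
def phi (G : SimpleGraph V) (v : V) : ℝ :=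
  degVec G ⬝ᵥ (((2 : ℝ) • Matrix.vecMulVec (fun i => forestMatrix G i v) (fun _ => (1 : ℝ))
    - forestMatrix G).mulVec (degVec G))

end Graph

/-! ### Twin pendent paths -/

section Twin

variable {V : Type*}

/-- The vertices, in order, of the first path attached at `v`; its `0`-th vertex is `v`. -/
def fstPath (v : V) (k₁ k₂ : ℕ) : Fin (k₁ + 1) → V ⊕ (Fin k₁ ⊕ Fin k₂) :=
  Fin.cases (Sum.inl v) (fun a => Sum.inr (Sum.inl a))

/-- The vertices, in order, of the second path attached at `v`; its `0`-th vertex is `v`. -/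
def sndPath (v : V) (k₁ k₂ : ℕ) : Fin (k₂ + 1) → V ⊕ (Fin k₁ ⊕ Fin k₂) :=
  Fin.cases (Sum.inl v) (fun b => Sum.inr (Sum.inr b))

/-- The graph obtained from `G` and two paths on `k₁ + 1` and `k₂ + 1` vertices by identifying the
first vertex of each path with `v`. -/
def tildeGraph (G : SimpleGraph V) (v : V) (k₁ k₂ : ℕ) :
    SimpleGraph (V ⊕ (Fin k₁ ⊕ Fin k₂)) :=
  G.map Sum.inl ⊔
    (SimpleGraph.pathGraph (k₁ + 1)).map (fstPath v k₁ k₂) ⊔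
    (SimpleGraph.pathGraph (k₂ + 1)).map (sndPath v k₁ k₂)

/-- The graph obtained from `tildeGraph G v k₁ k₂` by inserting the edge between the last vertices
of the two attached paths. -/
def hatGraph (G : SimpleGraph V) (v : V) (k₁ k₂ : ℕ) :
    SimpleGraph (V ⊕ (Fin k₁ ⊕ Fin k₂)) :=
  tildeGraph G v k₁ k₂ ⊔
    SimpleGraph.edge (fstPath v k₁ k₂ (Fin.last k₁)) (sndPath v k₁ k₂ (Fin.last k₂))

/-- `G` is `(v, k₁, k₂)`-paradoxical: inserting the edge between the ends of the twin pendent paths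
strictly increases Kemeny's constant of the random walk. -/
def IsParadoxical [Fintype V] (G : SimpleGraph V) (v : V) (k₁ k₂ : ℕ) : Prop :=
  ∃ K K' : ℝ, IsKemenyConstant (walkMatrix (tildeGraph G v k₁ k₂)) K ∧
    IsKemenyConstant (walkMatrix (hatGraph G v k₁ k₂)) K' ∧ K < K'

end Twin

/-- The sequence `G₁, G₂, …`, with specified vertices `v₁, v₂, …`, is asymptotically
`(k₁, k₂)`-paradoxical. -/
def IsAsympParadoxicalAt {V : ℕ+ → Type*} [∀ n, Fintype (V n)]
    (G : ∀ n, SimpleGraph (V n)) (v : ∀ n, V n) (k₁ k₂ : ℕ) : Prop :=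
  ∃ N : ℕ+, ∀ n ≥ N, IsParadoxical (G n) (v n) k₁ k₂

/-- The sequence `G₁, G₂, …`, with specified vertices `v₁, v₂, …`, is asymptotically
paradoxical. -/
def IsAsympParadoxical {V : ℕ+ → Type*} [∀ n, Fintype (V n)]
    (G : ∀ n, SimpleGraph (V n)) (v : ∀ n, V n) : Prop :=
  ∀ k₁ k₂ : ℕ, 2 ≤ k₁ + k₂ → IsAsympParadoxicalAt G v k₁ k₂

end TwinPaths

end

namespace TwinPaths

/-! ### Mean first passage times from the hitting equations -/

section FirstPassage

open Topology

/-! Write `R` for the matrix of effective resistances, `d` for the degree vector, `m` for the number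
of edges and `k = k₁ + k₂`. Kemeny's constant is `dᵀ R d / (4 m)`, and `R = F / τ`. Both facts come
from one algebraic characterization (`IsResistanceMatrix`): `R` is symmetric with zero diagonal and
`L R + 2 I = u 1ᵀ` for the Laplacian `L`. This equation yields the hitting times and hence Kemeny's
constant (`isKemenyConstant_iff`); a bijection between spanning trees and certain pairs of an edge
and a 2-forest shows that `F / τ` satisfies it (`isResistanceMatrix_forestMatrix_div`).

As `v` is a cut vertex, resistances in the extended graphs add across it
(`IsTwinExtension.isResistanceMatrix`): the attached part is a path with `k` edges, or a cycle with
`k + 1` edges once its ends are joined. Expanding `dᵀ R d` and cross-multiplying the two Kemeny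
constants leaves `4 m ∑ d_a R_{a,v} - dᵀ R d = φ / τ` as the only contribution of `G` beyond its
number of edges. Being paradoxical therefore means that `φ / (4 m² τ)` exceeds a threshold depending
on `k₁`, `k₂` and `m` alone (`isParadoxical_iff`).

As `m → ∞` the threshold converges to `k₁² + k₂² - (k² + 2k) / 3` (`tendsto_paradoxThreshold`), and
connectedness gives `m ≥ n - 1`. Divergence of the ratio thus beats every threshold. Conversely, the
limits for `k₂ = 0` are `(2 k₁² - 2 k₁) / 3`, which are unbounded, so beating every threshold forces
divergence. -/

lemma tendsto_natCast_mul_of_antitone_of_summable {S : ℕ → ℝ} (hanti : Antitone S)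
    (h0 : ∀ t, 0 ≤ S t) (hS : Summable S) : Tendsto (fun n : ℕ => (n : ℝ) * S n) atTop (𝓝 0) := by
  have hP := hS.hasSum.tendsto_sum_nat
  have hhalf : Tendsto (fun n : ℕ => n / 2) atTop atTop :=
    tendsto_atTop_mono (fun n => le_rfl) (Nat.tendsto_div_const_atTop (by norm_num))
  have hlim := ((hP.sub (hP.comp hhalf)).const_mul 2)
  rw [sub_self, mul_zero] at hlim
  refine squeeze_zero (fun n => mul_nonneg n.cast_nonneg (h0 n)) (fun n => ?_) hlim
  have hsplit : ∑ t ∈ Finset.range n, S t - ∑ t ∈ Finset.range (n / 2), S t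
      = ∑ t ∈ Finset.Ico (n / 2) n, S t :=
    (Finset.sum_Ico_eq_sub _ (Nat.div_le_self n 2)).symm
  -- The block from `n / 2` to `n` has at least `n / 2` terms, each at least `S n`, and the block
  -- sums tend to zero by summability.
  have hle : ((n - n / 2 : ℕ) : ℝ) * S n ≤ ∑ t ∈ Finset.Ico (n / 2) n, S t := by
    have := Finset.card_nsmul_le_sum (Finset.Ico (n / 2) n) S (S n)
      (fun t ht => hanti (Finset.mem_Ico.1 ht).2.le)
    simpa [nsmul_eq_mul] using this
  have hn : (n : ℝ) ≤ 2 * ((n - n / 2 : ℕ) : ℝ) := by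
    have : n ≤ 2 * (n - n / 2) := by omega
    exact_mod_cast this
  have := mul_le_mul_of_nonneg_right hn (h0 n)
  simp only [Function.comp_apply]
  rw [hsplit]
  linarith

variable {V : Type*} [Fintype V]

open Classical in
/-- The probability that the chain with transition matrix `M`, started at `i`, does not visit `j`
at the times `1, …, t`. -/
noncomputable def survivalProb (M : Matrix V V ℝ) (j : V) : ℕ → V → ℝ
  | 0, _ => 1
  | t + 1, i => ∑ l : V with l ≠ j, M i l * survivalProb M j t l

lemma survivalProb_nonneg {M : Matrix V V ℝ} (hM : ∀ i j, 0 ≤ M i j) (j : V) (t : ℕ) (i : V) :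
    0 ≤ survivalProb M j t i := by
  induction t generalizing i with
  | zero => simp [survivalProb]
  | succ t ih => exact Finset.sum_nonneg fun l _ => mul_nonneg (hM i l) (ih l)

open Classical in
lemma sum_ne_eq_one_sub {M : Matrix V V ℝ} (hrow : ∀ i, ∑ j, M i j = 1) (i j : V) :
    ∑ l : V with l ≠ j, M i l = 1 - M i j := by
  have h := Finset.sum_filter_add_sum_filter_not Finset.univ (fun l => l ≠ j) (fun l => M i l)
  rw [hrow] at h
  have h2 : ∑ l : V with ¬ l ≠ j, M i l = M i j := by
    rw [Finset.sum_filter]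
    simp
  linarith

lemma firstPassageProb_succ {M : Matrix V V ℝ} (hrow : ∀ i, ∑ j, M i j = 1) (j : V) (t : ℕ)
    (i : V) :
    firstPassageProb M j (t + 1) i = survivalProb M j t i - survivalProb M j (t + 1) i := by
  induction t generalizing i with
  | zero =>
    have := sum_ne_eq_one_sub hrow i j
    simp only [firstPassageProb, survivalProb, mul_one]
    linarith
  | succ t ih =>
    rw [firstPassageProb, survivalProb, survivalProb, ← Finset.sum_sub_distrib]
    refine Finset.sum_congr rfl fun l _ => ?_
    rw [ih, ← mul_sub]

lemma firstPassageProb_nonneg {M : Matrix V V ℝ} (hM : ∀ i j, 0 ≤ M i j) (j : V) (t : ℕ) (i : V) :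
    0 ≤ firstPassageProb M j t i := by
  match t with
  | 0 => simp [firstPassageProb]
  | 1 => simpa [firstPassageProb] using hM i j
  | t + 2 =>
    rw [firstPassageProb]
    exact Finset.sum_nonneg fun l _ =>
      mul_nonneg (hM i l) (firstPassageProb_nonneg hM j (t + 1) l)

-- Minimum principle: at a minimizer `a` with `h a < 0` the equation would give `M a j * h a ≥ 1`,
-- which is impossible.
open Classical in
lemma nonneg_of_hitting_equation {M : Matrix V V ℝ} (hM : ∀ i j, 0 ≤ M i j)
    (hrow : ∀ i, ∑ j, M i j = 1) {j : V} {h : V → ℝ}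
    (hh : ∀ i, h i = 1 + ∑ l : V with l ≠ j, M i l * h l) (i : V) : 0 ≤ h i := by
  have : Nonempty V := ⟨i⟩
  obtain ⟨a, ha⟩ := Finite.exists_min h
  refine le_trans ?_ (ha i)
  by_contra! hneg
  have h1 : (∑ l : V with l ≠ j, M a l) * h a ≤ ∑ l : V with l ≠ j, M a l * h l := by
    rw [Finset.sum_mul]
    exact Finset.sum_le_sum fun l _ => mul_le_mul_of_nonneg_left (ha l) (hM a l)
  rw [sum_ne_eq_one_sub hrow] at h1
  have h2 := hh a
  nlinarith [mul_nonneg_of_nonpos_of_nonpos (neg_nonpos.2 (hM a j)) hneg.le]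

open Classical in
/-- A solution of the linear equations for the expected hitting times of `j` yields the mean first
passage times. -/
lemma isMeanFirstPassageTime_of_hitting_equation {M : Matrix V V ℝ} (hM : ∀ i j, 0 ≤ M i j)
    (hrow : ∀ i, ∑ j, M i j = 1) {j : V} {h : V → ℝ}
    (hh : ∀ i, h i = 1 + ∑ l : V with l ≠ j, M i l * h l) (i : V) :
    IsMeanFirstPassageTime M i j (h i) := by
  have hpos := nonneg_of_hitting_equation hM hrow hh
  have hS0 := survivalProb_nonneg hM j
  obtain ⟨C, hC⟩ : ∃ C, ∀ i, h i ≤ C := by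
    have : Nonempty V := ⟨i⟩
    obtain ⟨a, ha⟩ := Finite.exists_max h
    exact ⟨h a, ha⟩
  -- Iterating the equation `t` times writes `h i` as a partial sum of survival probabilities plus
  -- the mean of `h` over the paths still avoiding `j`; that remainder lies between `0` and `C *
  -- survivalProb M j t i`.
  have hbound : ∀ t i, ∑ s ∈ Finset.range t, survivalProb M j s i ≤ h i ∧
      h i ≤ ∑ s ∈ Finset.range t, survivalProb M j s i + C * survivalProb M j t i := by
    intro t
    induction t with
    | zero => intro i; simpa [survivalProb] using ⟨hpos i, hC i⟩
    | succ t ih =>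
      intro i
      have hexp : ∑ s ∈ Finset.range (t + 1), survivalProb M j s i
          = 1 + ∑ l : V with l ≠ j, M i l * ∑ s ∈ Finset.range t, survivalProb M j s l := by
        rw [Finset.sum_range_succ', add_comm]
        congr 1
        simp only [survivalProb, Finset.mul_sum]
        rw [Finset.sum_comm]
      have hexp2 : C * survivalProb M j (t + 1) i
          = ∑ l : V with l ≠ j, M i l * (C * survivalProb M j t l) := by
        rw [survivalProb, Finset.mul_sum]
        exact Finset.sum_congr rfl fun l _ => by ring
      rw [hexp, hexp2, hh i, add_assoc, ← Finset.sum_add_distrib]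
      constructor
      · gcongr with l
        · exact hM i l
        · exact (ih l).1
      · gcongr with l
        rw [← mul_add]
        exact mul_le_mul_of_nonneg_left (ih l).2 (hM i l)
  have hsummable : Summable fun t => survivalProb M j t i :=
    summable_of_sum_range_le (fun t => hS0 t i) (fun t => (hbound t i).1)
  have hzero := hsummable.tendsto_atTop_zero
  have hsum : Tendsto (fun t => ∑ s ∈ Finset.range t, survivalProb M j s i) atTop (𝓝 (h i)) := by
    have hlow : Tendsto (fun t => h i - C * survivalProb M j t i) atTop (𝓝 (h i)) := by
      simpa using tendsto_const_nhds.sub (hzero.const_mul C)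
    exact tendsto_of_tendsto_of_tendsto_of_le_of_le hlow tendsto_const_nhds
      (fun t => by have := (hbound t i).2; simp only; linarith) (fun t => (hbound t i).1)
  have hanti : Antitone fun t => survivalProb M j t i := by
    refine antitone_nat_of_succ_le fun t => ?_
    have h1 := firstPassageProb_succ hrow j t i
    have h2 := firstPassageProb_nonneg hM j (t + 1) i
    linarith
  have hf0 := fun t => firstPassageProb_nonneg hM j t i
  constructor
  · rw [hasSum_iff_tendsto_nat_of_nonneg hf0, ← tendsto_add_atTop_iff_nat 1]
    have hpart : ∀ n, ∑ t ∈ Finset.range (n + 1), firstPassageProb M j t i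
        = 1 - survivalProb M j n i := by
      intro n
      rw [Finset.sum_range_succ']
      simp only [firstPassageProb_succ hrow]
      rw [Finset.sum_range_sub']
      simp [firstPassageProb, survivalProb]
    simp only [hpart]
    simpa using tendsto_const_nhds.sub hzero
  · rw [hasSum_iff_tendsto_nat_of_nonneg (fun t => mul_nonneg t.cast_nonneg (hf0 t)),
      ← tendsto_add_atTop_iff_nat 1]
    -- Summation by parts: the mean is the sum of the tails, up to a boundary term that vanishes in
    -- the limit.
    have hpart : ∀ n : ℕ, ∑ t ∈ Finset.range (n + 1), (t : ℝ) * firstPassageProb M j t i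
        = ∑ s ∈ Finset.range n, survivalProb M j s i - n * survivalProb M j n i := by
      intro n
      induction n with
      | zero => simp
      | succ n ih =>
        rw [Finset.sum_range_succ, ih, firstPassageProb_succ hrow, Finset.sum_range_succ]
        push_cast
        ring
    simp only [hpart]
    simpa using hsum.sub
      (tendsto_natCast_mul_of_antitone_of_summable hanti (fun t => hS0 t i) hsummable)

end FirstPassage

/-! ### Resistance matrices and Kemeny's constant -/

section Resistance

variable {V : Type*}

open Classical in
/-- The entries of the adjacency matrix. -/
noncomputable def adjWeight (G : SimpleGraph V) (i j : V) : ℝ := if G.Adj i j then 1 else 0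

lemma adjWeight_comm (G : SimpleGraph V) (i j : V) : adjWeight G i j = adjWeight G j i := by
  classical
  simp only [adjWeight]
  exact if_congr (G.adj_comm i j) rfl rfl

lemma adjWeight_nonneg (G : SimpleGraph V) (i j : V) : 0 ≤ adjWeight G i j := by
  unfold adjWeight; split_ifs <;> norm_num

variable [Fintype V]

lemma degVec_eq_sum (G : SimpleGraph V) (i : V) : degVec G i = ∑ j, adjWeight G i j := by
  classical
  simp only [degVec, adjWeight]
  rw [G.degree_eq_sum_if_adj (R := ℝ)]

lemma sum_degVec (G : SimpleGraph V) : ∑ i, degVec G i = 2 * numEdges G := by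
  classical
  have := G.sum_degrees_eq_twice_card_edges
  simp only [degVec, numEdges]
  exact_mod_cast this

lemma walkMatrix_eq (G : SimpleGraph V) (i j : V) :
    walkMatrix G i j = adjWeight G i j / degVec G i := by
  simp only [walkMatrix, adjWeight, Matrix.of_apply]
  split_ifs <;> simp

open Classical in
/-- The characterization `L R + 2 I = u 1ᵀ` of the matrix `R` of effective resistances of a graph
with Laplacian matrix `L`. -/
structure IsResistanceMatrix (G : SimpleGraph V) (R : V → V → ℝ) : Prop where
  symm : ∀ i j, R i j = R j i
  diag : ∀ i, R i i = 0
  laplacian : ∃ u : V → ℝ, ∀ i j,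
    ∑ l, adjWeight G i l * (R i j - R l j) = u i - if i = j then 2 else 0

variable {G : SimpleGraph V} {R : V → V → ℝ}

/-- At an isolated vertex `i` the Laplacian equation would read `u i = 2` for `j = i` and `u i = 0`
for `j ≠ i`. -/
lemma IsResistanceMatrix.degVec_pos [Nontrivial V] (hR : IsResistanceMatrix G R) (i : V) :
    0 < degVec G i := by
  classical
  obtain ⟨u, hu⟩ := hR.laplacian
  have h0 : 0 ≤ degVec G i := by simp [degVec]
  refine h0.lt_of_ne fun h => ?_
  have hz : ∀ l, adjWeight G i l = 0 := by
    rw [degVec_eq_sum] at h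
    have := (Finset.sum_eq_zero_iff_of_nonneg (fun l _ => adjWeight_nonneg G i l)).1 h.symm
    exact fun l => this l (Finset.mem_univ l)
  obtain ⟨j, hj⟩ := exists_ne i
  have h1 := hu i i
  have h2 := hu i j
  simp only [hz, zero_mul, Finset.sum_const_zero, if_true, if_neg hj.symm] at h1 h2
  linarith

/-- Harmonic functions are constant. -/
lemma IsResistanceMatrix.exists_eq_const (hR : IsResistanceMatrix G R) {x : V → ℝ}
    (hx : ∀ i, ∑ l, adjWeight G i l * (x i - x l) = 0) : ∃ c, ∀ i, x i = c := by
  classical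
  obtain ⟨u, hu⟩ := hR.laplacian
  refine ⟨(∑ i, x i * u i) / 2, fun j => ?_⟩
  -- The Laplacian is symmetric, so pairing `x` with `L R` moves `L` onto `x`, where it vanishes;
  -- what remains is `∑ x_i u_i = 2 x_j`.
  have h1 : ∑ i, x i * ∑ l, adjWeight G i l * (R i j - R l j)
      = ∑ i, (∑ l, adjWeight G i l * (x i - x l)) * R i j := by
    simp only [Finset.mul_sum, Finset.sum_mul, mul_sub, sub_mul, Finset.sum_sub_distrib]
    congr 1
    · exact Finset.sum_congr rfl fun i _ => Finset.sum_congr rfl fun l _ => by ring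
    · rw [Finset.sum_comm]
      refine Finset.sum_congr rfl fun i _ => Finset.sum_congr rfl fun l _ => ?_
      rw [adjWeight_comm G i l]; ring
  simp only [hx, zero_mul, Finset.sum_const_zero, hu] at h1
  simp only [mul_sub, mul_ite, mul_zero,
    Finset.sum_sub_distrib, Finset.sum_ite_eq', Finset.mem_univ, if_true] at h1
  linarith

/-- The sum `dᵀ R d` for the degree vector `d` of a graph. -/
noncomputable def degForm (G : SimpleGraph V) (R : V → V → ℝ) : ℝ :=
  ∑ i, ∑ j, degVec G i * degVec G j * R i j

lemma sum_walkMatrix (hd : ∀ i, 0 < degVec G i) (i : V) : ∑ j, walkMatrix G i j = 1 := by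
  simp only [walkMatrix_eq, ← Finset.sum_div]
  rw [← degVec_eq_sum, div_self (hd i).ne']

lemma walkMatrix_nonneg (i j : V) : 0 ≤ walkMatrix G i j := by
  rw [walkMatrix_eq]
  exact div_nonneg (adjWeight_nonneg G i j) (by simp [degVec])

lemma IsResistanceMatrix.stationary_eq [Nontrivial V] (hR : IsResistanceMatrix G R) {w : V → ℝ}
    (hw : IsStationaryDistribution (walkMatrix G) w) (i : V) :
    w i = degVec G i / ∑ k, degVec G k := by
  have hd := hR.degVec_pos
  obtain ⟨-, hsum, hstat⟩ := hw
  -- By reversibility, stationarity of `w` says that `w / d` is harmonic.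
  obtain ⟨c, hc⟩ := hR.exists_eq_const (x := fun i => w i / degVec G i) (fun i => by
    have h := congrFun hstat i
    simp only [Matrix.vecMul, dotProduct, walkMatrix_eq] at h
    simp only [mul_sub, Finset.sum_sub_distrib]
    rw [← Finset.sum_mul, ← degVec_eq_sum, mul_div_cancel₀ _ (hd i).ne', ← h, sub_eq_zero]
    refine Finset.sum_congr rfl fun l _ => ?_
    rw [adjWeight_comm G i l]; ring)
  have hwc : ∀ i, w i = c * degVec G i := fun i => by
    rw [← hc i, div_mul_cancel₀ _ (hd i).ne']
  simp only [hwc, ← Finset.mul_sum] at hsum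
  have hne : (∑ k, degVec G k) ≠ 0 := right_ne_zero_of_mul_eq_one hsum
  rw [hwc, eq_div_iff hne, mul_right_comm, hsum, one_mul]

open Classical in
/-- Mean first passage times in terms of effective resistances. -/
lemma IsResistanceMatrix.isMeanFirstPassageTime [Nontrivial V] (hR : IsResistanceMatrix G R)
    (i j : V) :
    IsMeanFirstPassageTime (walkMatrix G) i j
      ((∑ k, degVec G k * (R i j + R j k - R i k)) / 2 +
        if i = j then (∑ k, degVec G k) / degVec G j else 0) := by
  have hd := hR.degVec_pos
  obtain ⟨u, hu⟩ := hR.laplacian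
  set N := ∑ k, degVec G k with hN
  set g : V → ℝ := fun i => (∑ k, degVec G k * (R i j + R j k - R i k)) / 2 with hg
  have hgj : g j = 0 := by simp [hg, hR.diag]
  -- In `g i - g l` the terms `R j k` drop out, and the two copies of `u i` cancel, leaving only
  -- point masses at `j` and `k`.
  have hstep : ∀ i, ∑ l, adjWeight G i l * (g i - g l)
      = degVec G i - if i = j then N else 0 := by
    intro i
    have hdiff : ∀ l, g i - g l
        = ∑ k, degVec G k / 2 * ((R i j - R l j) - (R i k - R l k)) := by
      intro l
      simp only [hg]
      rw [← sub_div, ← Finset.sum_sub_distrib, Finset.sum_div]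
      exact Finset.sum_congr rfl fun k _ => by ring
    have : ∑ l, adjWeight G i l * (g i - g l)
        = ∑ k, degVec G k / 2 * ((∑ l, adjWeight G i l * (R i j - R l j))
            - ∑ l, adjWeight G i l * (R i k - R l k)) := by
      simp only [hdiff, Finset.mul_sum, ← Finset.sum_sub_distrib]
      rw [Finset.sum_comm]
      exact Finset.sum_congr rfl fun k _ => Finset.sum_congr rfl fun l _ => by ring
    rw [this]
    simp only [hu]
    have : ∀ k, degVec G k / 2 * ((u i - if i = j then 2 else 0) - (u i - if i = k then 2 else 0))
        = (if i = k then degVec G k else 0) - (if i = j then 1 else 0) * degVec G k := by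
      intro k; split_ifs <;> ring
    simp only [this, Finset.sum_sub_distrib, ← Finset.mul_sum]
    simp [hN]
  refine isMeanFirstPassageTime_of_hitting_equation (M := walkMatrix G) walkMatrix_nonneg
    (sum_walkMatrix hd) (h := fun i => g i + if i = j then N / degVec G j else 0) ?_ i
  intro i
  -- Because `g j = 0`, excluding `l = j` costs nothing for `g`, while it removes the return-time
  -- correction at `j`.
  have hkill : ∑ l : V with l ≠ j, walkMatrix G i l * (g l + if l = j then N / degVec G j else 0)
      = ∑ l, walkMatrix G i l * g l := by
    rw [Finset.sum_filter]
    refine Finset.sum_congr rfl fun l _ => ?_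
    by_cases hl : l = j
    · simp [hl, hgj]
    · simp [hl]
  rw [hkill]
  have h1 := hstep i
  simp only [mul_sub, Finset.sum_sub_distrib] at h1
  rw [← Finset.sum_mul, ← degVec_eq_sum] at h1
  have h2 : ∑ l, walkMatrix G i l * g l = (∑ l, adjWeight G i l * g l) / degVec G i := by
    rw [Finset.sum_div]
    exact Finset.sum_congr rfl fun l _ => by rw [walkMatrix_eq]; ring
  rw [h2]
  have hdi := (hd i).ne'
  have h3 : ∑ l, adjWeight G i l * g l
      = degVec G i * g i - degVec G i + if i = j then N else 0 := by linarith
  rw [h3]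
  by_cases hij : i = j
  · subst hij; simp only [if_true]; field_simp; ring
  · simp only [if_neg hij]; field_simp; ring

lemma IsResistanceMatrix.isStationaryDistribution [Nontrivial V] (hR : IsResistanceMatrix G R) :
    IsStationaryDistribution (walkMatrix G) (fun i => degVec G i / ∑ k, degVec G k) := by
  have hd := hR.degVec_pos
  have hN : 0 < ∑ k, degVec G k := Finset.sum_pos (fun k _ => hd k) Finset.univ_nonempty
  refine ⟨fun i => div_nonneg (hd i).le hN.le, ?_, ?_⟩
  · rw [← Finset.sum_div, div_self hN.ne']
  · ext i
    simp only [Matrix.vecMul, dotProduct, walkMatrix_eq]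
    rw [degVec_eq_sum G i, Finset.sum_div]
    refine Finset.sum_congr rfl fun l _ => ?_
    rw [adjWeight_comm G i l]
    have := (hd l).ne'
    field_simp

open Classical in
lemma IsResistanceMatrix.sum_hitting (hR : IsResistanceMatrix G R) (i : V) :
    ∑ j : V with j ≠ i, ((∑ k, degVec G k * (R i j + R j k - R i k)) / 2 +
        if i = j then (∑ k, degVec G k) / degVec G j else 0) * (degVec G j / ∑ k, degVec G k)
      = degForm G R / (2 * ∑ k, degVec G k) := by
  set N := ∑ k, degVec G k with hN
  have h1 : ∀ j, (if j ≠ i then ((∑ k, degVec G k * (R i j + R j k - R i k)) / 2 +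
        if i = j then N / degVec G j else 0) * (degVec G j / N) else 0)
      = (∑ k, (degVec G j * degVec G k * R i j + degVec G j * degVec G k * R j k
          - degVec G j * degVec G k * R i k)) / (2 * N) := by
    intro j
    have h2 : ∑ k, (degVec G j * degVec G k * R i j + degVec G j * degVec G k * R j k
          - degVec G j * degVec G k * R i k)
        = (∑ k, degVec G k * (R i j + R j k - R i k)) * degVec G j := by
      rw [Finset.sum_mul]
      exact Finset.sum_congr rfl fun k _ => by ring
    rw [h2]
    by_cases hj : j = i
    · subst hj; simp [hR.diag]
    · rw [if_pos hj, if_neg (Ne.symm hj), add_zero, div_mul_div_comm]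
  rw [Finset.sum_filter, Finset.sum_congr rfl fun j _ => h1 j, ← Finset.sum_div]
  congr 1
  simp only [Finset.sum_sub_distrib, Finset.sum_add_distrib, degForm]
  -- Exchanging the summation variables makes the two terms involving `i` cancel; this is why the
  -- starting state is irrelevant.
  have h3 : ∑ j, ∑ k, degVec G j * degVec G k * R i j
      = ∑ j, ∑ k, degVec G j * degVec G k * R i k := by
    rw [Finset.sum_comm]
    exact Finset.sum_congr rfl fun j _ => Finset.sum_congr rfl fun k _ => by ring
  rw [h3]; ring

/-- Kemeny's constant in terms of effective resistances. -/
theorem IsResistanceMatrix.isKemenyConstant_iff [Nontrivial V] (hR : IsResistanceMatrix G R)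
    (K : ℝ) :
    IsKemenyConstant (walkMatrix G) K ↔ K = degForm G R / (4 * numEdges G) := by
  classical
  have hN : (4 * numEdges G : ℝ) = 2 * ∑ k, degVec G k := by rw [sum_degVec]; ring
  rw [hN]
  constructor
  · rintro ⟨m, w, hm, hw, hK⟩
    obtain ⟨i⟩ := (inferInstance : Nonempty V)
    rw [← hK i, ← hR.sum_hitting i]
    refine Finset.sum_congr (by ext; simp) fun j _ => ?_
    rw [hR.stationary_eq hw, (hm i j).2.unique (hR.isMeanFirstPassageTime i j).2]
  · rintro rfl
    refine ⟨_, _, hR.isMeanFirstPassageTime, hR.isStationaryDistribution, fun i => ?_⟩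
    rw [← hR.sum_hitting i]

end Resistance

/-! ### Effective resistances from spanning trees and 2-forests -/

section Forests

variable {V : Type*} {F T : SimpleGraph V} {i j l x : V}

lemma reachable_or_of_card_connectedComponent_eq_two
    (hF : Nat.card F.ConnectedComponent = 2) (hil : ¬ F.Reachable i l) (x : V) :
    F.Reachable i x ∨ F.Reachable l x := by
  obtain ⟨c, -, hc⟩ := (Nat.card_eq_two_iff' (F.connectedComponentMk i)).1 hF
  by_contra! h
  have h1 := hc (F.connectedComponentMk x)
    (fun e => h.1 (SimpleGraph.ConnectedComponent.exact e).symm)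
  have h2 := hc (F.connectedComponentMk l)
    (fun e => hil (SimpleGraph.ConnectedComponent.exact e).symm)
  exact h.2 (SimpleGraph.ConnectedComponent.exact (h2.trans h1.symm))

lemma card_connectedComponent_eq_two (hil : ¬ F.Reachable i l)
    (hcover : ∀ x, F.Reachable i x ∨ F.Reachable l x) :
    Nat.card F.ConnectedComponent = 2 := by
  rw [Nat.card_eq_two_iff]
  refine ⟨F.connectedComponentMk i, F.connectedComponentMk l,
    fun e => hil (SimpleGraph.ConnectedComponent.exact e), ?_⟩
  rw [Set.eq_univ_iff_forall]
  intro c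
  induction c using SimpleGraph.ConnectedComponent.ind with
  | h x =>
    rcases hcover x with h | h
    · exact Or.inl (SimpleGraph.ConnectedComponent.sound h.symm)
    · exact Or.inr (SimpleGraph.ConnectedComponent.sound h.symm)

/-- Joining the two trees of a forest by an edge gives a tree. -/
lemma isTree_sup_edge (hF : F.IsAcyclic) (hcard : Nat.card F.ConnectedComponent = 2)
    (hil : ¬ F.Reachable i l) : (F ⊔ SimpleGraph.edge i l).IsTree := by
  have hne : i ≠ l := fun h => hil (h ▸ SimpleGraph.Reachable.refl i)
  refine ⟨?_, hF.sup_edge_of_not_reachable hil⟩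
  rw [SimpleGraph.connected_iff_exists_forall_reachable]
  refine ⟨i, fun x => ?_⟩
  have hadj : (F ⊔ SimpleGraph.edge i l).Adj i l := by simp [SimpleGraph.edge_adj, hne]
  rcases reachable_or_of_card_connectedComponent_eq_two hcard hil x with h | h
  · exact h.mono le_sup_left
  · exact hadj.reachable.trans (h.mono le_sup_left)

lemma reachable_deleteEdges_or (p : T.Walk x i) (l : V) :
    (T.deleteEdges {s(i, l)}).Reachable i x ∨ (T.deleteEdges {s(i, l)}).Reachable l x := by
  induction p with
  | nil => exact Or.inl (SimpleGraph.Reachable.refl _)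
  | @cons a b c h p ih =>
    by_cases hab : s(a, b) = s(c, l)
    · rcases Sym2.eq_iff.1 hab with ⟨rfl, -⟩ | ⟨rfl, -⟩
      · exact Or.inl (SimpleGraph.Reachable.refl _)
      · exact Or.inr (SimpleGraph.Reachable.refl _)
    · have hadj : (T.deleteEdges {s(c, l)}).Adj b a := by
        rw [SimpleGraph.deleteEdges_adj]
        exact ⟨h.symm, by rwa [Set.mem_singleton_iff, Sym2.eq_swap (a := b)]⟩
      exact ih.imp (fun h' => h'.trans hadj.reachable) (fun h' => h'.trans hadj.reachable)

/-- Every spanning tree has an edge at `i` whose removal separates `i` from `j`. -/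
lemma exists_forest_sup_edge_eq (hT : T.IsTree) (hij : i ≠ j) :
    ∃ l F, T.Adj i l ∧ F ≤ T ∧ F.IsAcyclic ∧ Nat.card F.ConnectedComponent = 2 ∧
      ¬ F.Reachable i j ∧ F.Reachable l j ∧ F ⊔ SimpleGraph.edge i l = T := by
  obtain ⟨p, hp⟩ := hT.connected.exists_isPath i j
  cases p with
  | nil => exact absurd rfl hij
  | @cons _ l _ hil p =>
    rw [SimpleGraph.Walk.cons_isPath_iff] at hp
    have hbridge : ¬ (T.deleteEdges {s(i, l)}).Reachable i l :=
      SimpleGraph.isAcyclic_iff_forall_isBridge.1 hT.isAcyclic (e := s(i, l)) hil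
    -- The removed edge is the first one on the path from `i` to `j`; the rest of the path avoids
    -- `i` and so survives.
    have hlj : (T.deleteEdges {s(i, l)}).Reachable l j :=
      ⟨p.toDeleteEdges {s(i, l)} fun e he heq => by
        rw [Set.mem_singleton_iff] at heq
        subst heq
        exact hp.2 (p.fst_mem_support_of_mem_edges he)⟩
    refine ⟨l, T.deleteEdges {s(i, l)}, hil, T.deleteEdges_le _,
      hT.isAcyclic.anti (T.deleteEdges_le _), card_connectedComponent_eq_two hbridge fun x => ?_,
      fun h => hbridge (h.trans hlj.symm), hlj, ?_⟩
    · obtain ⟨q⟩ := hT.connected.preconnected x i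
      exact reachable_deleteEdges_or q l
    · ext a b
      simp only [SimpleGraph.sup_adj, SimpleGraph.deleteEdges_adj, SimpleGraph.edge_adj,
        Set.mem_singleton_iff, Sym2.eq_iff]
      constructor
      · rintro (h | ⟨⟨rfl, rfl⟩ | ⟨rfl, rfl⟩, -⟩)
        exacts [h.1, hil, hil.symm]
      · intro h
        have := h.ne
        tauto

/-- A walk to `j` in `F'` never meets `i`, so it cannot use the extra edge, which is incident to
`i`. -/
lemma reachable_of_le_sup_edge {F' : SimpleGraph V} (hle : F' ≤ F ⊔ SimpleGraph.edge i l)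
    {a : V} (p : F'.Walk a j) (hi : ¬ F'.Reachable i j) : F.Reachable a j := by
  induction p with
  | nil => exact SimpleGraph.Reachable.refl _
  | @cons a b c h p ih =>
    refine SimpleGraph.Reachable.trans (SimpleGraph.Adj.reachable ?_) (ih hi)
    have hbc : F'.Reachable b c := ⟨p⟩
    have hac : F'.Reachable a c := h.reachable.trans hbc
    have ha : a ≠ i := by rintro rfl; exact hi hac
    have hb : b ≠ i := by rintro rfl; exact hi hbc
    have := hle h
    simp only [SimpleGraph.sup_adj, SimpleGraph.edge_adj] at this
    tauto

lemma eq_of_sup_edge_eq {F' : SimpleGraph V} {l' : V} (hij : ¬ F.Reachable i j)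
    (hlj : F.Reachable l j) (hij' : ¬ F'.Reachable i j) (hlj' : F'.Reachable l' j)
    (h : F ⊔ SimpleGraph.edge i l = F' ⊔ SimpleGraph.edge i l') : l = l' ∧ F = F' := by
  have hil : ¬ F.Reachable i l := fun h => hij (h.trans hlj)
  have hil' : ¬ F'.Reachable i l' := fun h => hij' (h.trans hlj')
  have hne' : i ≠ l' := fun h => hil' (h ▸ SimpleGraph.Reachable.refl i)
  -- Otherwise the edge from `i` to `l'` lies in `F`, and so does a walk in `F'` from `l'` to `j`,
  -- joining `i` to `j` in `F`.
  have hll : l = l' := by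
    by_contra hne
    have hadj : (F ⊔ SimpleGraph.edge i l).Adj i l' := by
      rw [h]; simp [SimpleGraph.edge_adj, hne']
    have hadj' : F.Adj i l' := by
      simp only [SimpleGraph.sup_adj, SimpleGraph.edge_adj] at hadj
      grind
    obtain ⟨p⟩ := hlj'
    exact hij (hadj'.reachable.trans
      (reachable_of_le_sup_edge (le_sup_left.trans h.ge) p hij'))
  subst hll
  refine ⟨rfl, ?_⟩
  have hFa : ¬ F.Adj i l := fun h => hil h.reachable
  have hFa' : ¬ F'.Adj i l := fun h => hil' h.reachable
  ext a b
  have := congrArg (fun H : SimpleGraph V => H.Adj a b) h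
  simp only [SimpleGraph.sup_adj, SimpleGraph.edge_adj, eq_iff_iff] at this
  have h1 := F.adj_comm a b
  have h2 := F'.adj_comm a b
  grind

variable [Fintype V]

open Classical in
/-- The 2-tree spanning forests of `G`. -/
noncomputable def twoTreeForests (G : SimpleGraph V) : Finset (SimpleGraph V) :=
  {F | F ≤ G ∧ F.IsAcyclic ∧ Nat.card F.ConnectedComponent = 2}

lemma mem_twoTreeForests {G : SimpleGraph V} : F ∈ twoTreeForests G ↔
    F ≤ G ∧ F.IsAcyclic ∧ Nat.card F.ConnectedComponent = 2 := by
  simp [twoTreeForests]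

open Classical in
lemma forestMatrix_eq_sum (G : SimpleGraph V) (i j : V) :
    forestMatrix G i j = ∑ F ∈ twoTreeForests G, if F.Reachable i j then (0 : ℝ) else 1 := by
  have hset : twoForests G i j = ↑({F ∈ twoTreeForests G | ¬ F.Reachable i j}) := by
    ext F
    simp [twoForests, mem_twoTreeForests, and_assoc]
  simp only [forestMatrix, Matrix.of_apply]
  rw [hset, Set.ncard_coe_finset, Finset.card_filter, Nat.cast_sum]
  refine Finset.sum_congr rfl fun F _ => ?_
  split_ifs <;> simp_all

open Classical in
/-- The spanning trees of `G` correspond to the pairs of a neighbour `l` of `i` and a 2-tree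
spanning forest in which `l`, but not `i`, is in the tree of `j`. -/
lemma sum_adjWeight_mul_forests (G : SimpleGraph V) (hij : i ≠ j) :
    ∑ l, adjWeight G i l * ∑ F ∈ twoTreeForests G,
      (if F.Reachable l j ∧ ¬ F.Reachable i j then (1 : ℝ) else 0) = numSpanningTrees G := by
  set X : Finset (V × SimpleGraph V) := {p ∈ Finset.univ ×ˢ twoTreeForests G |
    G.Adj i p.1 ∧ p.2.Reachable p.1 j ∧ ¬ p.2.Reachable i j} with hX
  have hcard : (X : Set (V × SimpleGraph V)).ncard = numSpanningTrees G := by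
    refine Set.ncard_congr (fun p _ => p.2 ⊔ SimpleGraph.edge i p.1) ?_ ?_ ?_
    · rintro ⟨l, F⟩ h
      simp only [hX, Finset.coe_filter, Finset.mem_product, Finset.mem_univ, true_and,
        mem_twoTreeForests, Set.mem_ofPred_eq] at h
      obtain ⟨⟨hle, hF, hc⟩, hil, hlj, hij'⟩ := h
      exact ⟨sup_le hle ((SimpleGraph.edge_le_iff _).2 (Or.inr hil)),
        isTree_sup_edge hF hc fun h => hij' (h.trans hlj)⟩
    · rintro ⟨l, F⟩ ⟨l', F'⟩ h h' heq
      simp only [hX, Finset.coe_filter, Finset.mem_product, Finset.mem_univ, true_and,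
        mem_twoTreeForests, Set.mem_ofPred_eq] at h h'
      obtain ⟨rfl, rfl⟩ := eq_of_sup_edge_eq h.2.2.2 h.2.2.1 h'.2.2.2 h'.2.2.1 heq
      rfl
    · rintro T ⟨hTG, hT⟩
      obtain ⟨l, F, hil, hFT, hF, hc, hij', hlj, heq⟩ := exists_forest_sup_edge_eq hT hij
      refine ⟨(l, F), ?_, heq⟩
      simp only [hX, Finset.coe_filter, Finset.mem_product, Finset.mem_univ, true_and,
        mem_twoTreeForests, Set.mem_ofPred_eq]
      exact ⟨⟨hFT.trans hTG, hF, hc⟩, hTG hil, hlj, hij'⟩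
  rw [← hcard, Set.ncard_coe_finset, hX, Finset.card_filter, Nat.cast_sum, Finset.sum_product]
  refine Finset.sum_congr rfl fun l _ => ?_
  rw [Finset.mul_sum]
  refine Finset.sum_congr rfl fun F _ => ?_
  by_cases h : G.Adj i l <;> simp [adjWeight, h]

lemma forestMatrix_comm (G : SimpleGraph V) (i j : V) : forestMatrix G i j = forestMatrix G j i := by
  classical
  simp only [forestMatrix_eq_sum]
  exact Finset.sum_congr rfl fun F _ => if_congr (SimpleGraph.reachable_comm) rfl rfl

lemma forestMatrix_self (G : SimpleGraph V) (i : V) : forestMatrix G i i = 0 := by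
  classical
  simp [forestMatrix_eq_sum]

-- The identity holds forest by forest: three vertices distributed over two trees leave few cases,
-- and `i` separated from both `j` and `l` is the one counted twice. Summed over neighbours `l` of
-- `i`, it turns the tree count into the Laplacian equation.
open Classical in
lemma forestMatrix_sub (G : SimpleGraph V) (i j l : V) :
    forestMatrix G i j - forestMatrix G l j = 2 * ∑ F ∈ twoTreeForests G,
      (if F.Reachable l j ∧ ¬ F.Reachable i j then (1 : ℝ) else 0) - forestMatrix G i l := by
  simp only [forestMatrix_eq_sum, Finset.mul_sum, ← Finset.sum_sub_distrib]
  refine Finset.sum_congr rfl fun F hF => ?_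
  obtain ⟨-, -, hc⟩ := mem_twoTreeForests.1 hF
  by_cases hij : F.Reachable i j <;> by_cases hlj : F.Reachable l j
  · have hil : F.Reachable i l := hij.trans hlj.symm
    simp [hij, hlj, hil]
  · have hil : ¬ F.Reachable i l := fun h => hlj (h.symm.trans hij)
    simp [hij, hlj, hil]
  · have hil : ¬ F.Reachable i l := fun h => hij (h.trans hlj)
    simp [hij, hlj, hil]; norm_num
  · have hil : F.Reachable i l := by
      by_contra hil
      exact (reachable_or_of_card_connectedComponent_eq_two hc hil j).elim hij hlj
    simp [hij, hlj, hil]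

lemma numSpanningTrees_pos {G : SimpleGraph V} (hG : G.Connected) : 0 < numSpanningTrees G := by
  obtain ⟨T, hT⟩ := hG.exists_isTree_le
  exact (Set.ncard_pos (Set.toFinite _)).2 ⟨T, hT⟩

/-- Effective resistances are ratios of numbers of 2-tree spanning forests and spanning trees. -/
theorem isResistanceMatrix_forestMatrix_div {G : SimpleGraph V} (hG : G.Connected) :
    IsResistanceMatrix G (fun i j => forestMatrix G i j / numSpanningTrees G) := by
  classical
  have hτ : (numSpanningTrees G : ℝ) ≠ 0 := by exact_mod_cast (numSpanningTrees_pos hG).ne'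
  -- The choice of `u` is forced by the case `i = j`; for `i ≠ j` the `2` in it comes from the count
  -- of spanning trees.
  refine ⟨fun i j => by rw [forestMatrix_comm], fun i => by rw [forestMatrix_self, zero_div],
    fun i => 2 - ∑ l, adjWeight G i l * (forestMatrix G i l / numSpanningTrees G), fun i j => ?_⟩
  by_cases hij : i = j
  · subst hij
    simp [forestMatrix_self, forestMatrix_comm G i]
  · have h1 : ∀ l, adjWeight G i l * (forestMatrix G i j / numSpanningTrees G
        - forestMatrix G l j / numSpanningTrees G)
        = 2 * (adjWeight G i l * ∑ F ∈ twoTreeForests G,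
          (if F.Reachable l j ∧ ¬ F.Reachable i j then (1 : ℝ) else 0)) / numSpanningTrees G
          - adjWeight G i l * (forestMatrix G i l / numSpanningTrees G) := by
      intro l
      rw [← sub_div, forestMatrix_sub]
      ring
    simp only [h1, Finset.sum_sub_distrib, ← Finset.sum_div, ← Finset.mul_sum]
    rw [sum_adjWeight_mul_forests G hij, mul_div_cancel_right₀ _ hτ, if_neg hij, sub_zero]

end Forests

/-! ### Paths along vertex sequences -/

section PathAlong

variable {V : Type*}

/-- The graph whose edges join consecutive terms of the sequence `q 0, …, q n`. -/
def pathAlong (q : ℕ → V) : ℕ → SimpleGraph V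
  | 0 => ⊥
  | n + 1 => pathAlong q n ⊔ SimpleGraph.edge (q n) (q (n + 1))

lemma pathAlong_adj {q : ℕ → V} {n : ℕ} (hq : Set.InjOn q (Set.Iic n)) {a b : V} :
    (pathAlong q n).Adj a b ↔
      ∃ t < n, (a = q t ∧ b = q (t + 1)) ∨ (a = q (t + 1) ∧ b = q t) := by
  induction n with
  | zero => simp [pathAlong]
  | succ n ih =>
    have hne : q n ≠ q (n + 1) := fun h => by
      have := hq (Set.mem_Iic.2 n.le_succ) (Set.mem_Iic.2 le_rfl) h
      omega
    rw [pathAlong, SimpleGraph.sup_adj, SimpleGraph.edge_adj,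
      ih (hq.mono (Set.Iic_subset_Iic.2 n.le_succ))]
    constructor
    · rintro (⟨t, ht, h⟩ | ⟨h, -⟩)
      · exact ⟨t, by omega, h⟩
      · exact ⟨n, by omega, by tauto⟩
    · rintro ⟨t, ht, h⟩
      rcases Nat.lt_succ_iff_lt_or_eq.1 ht with ht | rfl
      · exact Or.inl ⟨t, ht, h⟩
      · refine Or.inr ⟨by tauto, ?_⟩
        rcases h with ⟨rfl, rfl⟩ | ⟨rfl, rfl⟩
        exacts [hne, hne.symm]

end PathAlong

/-! ### Sums over ordered adjacent pairs and the weak Laplacian equation -/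

section DartSum

variable {V W : Type*} [Fintype V] [Fintype W]

/-- The sum of `f a b` over all ordered pairs `(a, b)` of adjacent vertices. -/
noncomputable def dartSum (G : SimpleGraph V) (f : V → V → ℝ) : ℝ :=
  ∑ a, ∑ b, adjWeight G a b * f a b

lemma dartSum_sup {G H : SimpleGraph V} (hGH : ∀ a b, G.Adj a b → ¬ H.Adj a b)
    (f : V → V → ℝ) : dartSum (G ⊔ H) f = dartSum G f + dartSum H f := by
  classical
  simp only [dartSum, ← Finset.sum_add_distrib, ← add_mul]
  refine Finset.sum_congr rfl fun a _ => Finset.sum_congr rfl fun b _ => ?_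
  congr 1
  have := hGH a b
  by_cases h : G.Adj a b <;> by_cases h' : H.Adj a b <;> simp_all [adjWeight]

lemma dartSum_bot (f : V → V → ℝ) : dartSum (⊥ : SimpleGraph V) f = 0 := by
  simp [dartSum, adjWeight]

lemma dartSum_edge {a b : V} (hab : a ≠ b) (f : V → V → ℝ) :
    dartSum (SimpleGraph.edge a b) f = f a b + f b a := by
  classical
  have h : ∀ x y, adjWeight (SimpleGraph.edge a b) x y * f x y
      = (if x = a then if y = b then f a b else 0 else 0)
        + if x = b then if y = a then f b a else 0 else 0 := by
    intro x y
    simp only [adjWeight, SimpleGraph.edge_adj]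
    by_cases h1 : x = a <;> by_cases h2 : x = b <;> by_cases h3 : y = a <;> by_cases h4 : y = b <;>
      simp_all
  simp [dartSum, h, Finset.sum_add_distrib]

lemma dartSum_map_inl {U : Type*} [Fintype U] (G : SimpleGraph V) (f : V ⊕ U → V ⊕ U → ℝ) :
    dartSum (G.map Sum.inl) f = dartSum G fun a b => f (Sum.inl a) (Sum.inl b) := by
  classical
  have h1 : ∀ a b, adjWeight (G.map (Sum.inl : V → V ⊕ U)) (Sum.inl a) (Sum.inl b)
      = adjWeight G a b := by
    intro a b
    simp only [adjWeight]
    have : (G.map (Sum.inl : V → V ⊕ U)).Adj (Sum.inl a) (Sum.inl b) ↔ G.Adj a b := by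
      rw [SimpleGraph.map_adj']
      constructor
      · rintro ⟨-, x, y, h, hx, hy⟩
        rwa [← Sum.inl.inj hx, ← Sum.inl.inj hy]
      · exact fun h => ⟨fun e => h.ne (Sum.inl.inj e), a, b, h, rfl, rfl⟩
    simp only [this]
  have h2 : ∀ a b, adjWeight (G.map (Sum.inl : V → V ⊕ U)) (Sum.inl a) (Sum.inr b) = 0 := by
    intro a b
    simp [adjWeight, SimpleGraph.map_adj']
  have h3 : ∀ a b, adjWeight (G.map (Sum.inl : V → V ⊕ U)) (Sum.inr a) b = 0 := by
    intro a b
    simp [adjWeight, SimpleGraph.map_adj']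
  simp [dartSum, Fintype.sum_sum_type, h1, h2, h3]

lemma dartSum_fst (G : SimpleGraph V) (f : V → ℝ) :
    dartSum G (fun a _ => f a) = ∑ a, degVec G a * f a := by
  simp only [dartSum, degVec_eq_sum, Finset.sum_mul]

lemma dartSum_laplacian {G : SimpleGraph V} {R : V → V → ℝ} {u : V → ℝ} {j : V} [DecidableEq V]
    (hu : ∀ i, ∑ l, adjWeight G i l * (R i j - R l j) = u i - if i = j then 2 else 0)
    (h : V → ℝ) :
    dartSum G (fun a b => h a * (R a j - R b j)) = ∑ a, h a * u a - 2 * h j := by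
  have h1 : ∀ a, ∑ b, adjWeight G a b * (h a * (R a j - R b j))
      = h a * u a - if a = j then 2 * h a else 0 := by
    intro a
    have : ∑ b, adjWeight G a b * (h a * (R a j - R b j))
        = h a * ∑ b, adjWeight G a b * (R a j - R b j) := by
      rw [Finset.mul_sum]
      exact Finset.sum_congr rfl fun b _ => by ring
    rw [this, hu]
    split_ifs <;> ring
  simp [dartSum, h1, Finset.sum_sub_distrib]

/-- Weak form of the Laplacian equation, recovered by testing with point masses. What matters is
that `U` does not depend on `j`. In this form the equation can be checked separately on
edge-disjoint pieces of a graph. -/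
lemma isResistanceMatrix_of_dartSum {G : SimpleGraph V} {R : V → V → ℝ}
    (hsymm : ∀ i j, R i j = R j i) (hdiag : ∀ i, R i i = 0) (U : (V → ℝ) → ℝ)
    (hU : ∀ (h : V → ℝ) (j : V), dartSum G (fun a b => h a * (R a j - R b j)) = U h - 2 * h j) :
    IsResistanceMatrix G R := by
  classical
  refine ⟨hsymm, hdiag, fun i => U (Pi.single i 1), fun i j => ?_⟩
  have h := hU (Pi.single i 1) j
  have h1 : dartSum G (fun a b => (Pi.single i 1 : V → ℝ) a * (R a j - R b j))
      = ∑ l, adjWeight G i l * (R i j - R l j) := by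
    rw [dartSum, Finset.sum_eq_single i]
    · simp
    · intro a _ ha; simp [ha]
    · simp
  rw [← h1, h]
  by_cases hij : i = j
  · subst hij; simp
  · simp [hij, Ne.symm hij]

lemma dartSum_pathAlong {q : ℕ → V} {n : ℕ} (hq : Set.InjOn q (Set.Iic n)) (f : V → V → ℝ) :
    dartSum (pathAlong q n) f
      = ∑ t ∈ Finset.range n, (f (q t) (q (t + 1)) + f (q (t + 1)) (q t)) := by
  induction n with
  | zero => simp [pathAlong, dartSum_bot]
  | succ n ih =>
    have hq' := hq.mono (Set.Iic_subset_Iic.2 n.le_succ)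
    have hinj : ∀ s t, s ≤ n + 1 → t ≤ n + 1 → q s = q t → s = t := fun s t hs ht h =>
      hq (Set.mem_Iic.2 hs) (Set.mem_Iic.2 ht) h
    have hne : q n ≠ q (n + 1) := fun h => by
      have := hinj _ _ n.le_succ le_rfl h
      omega
    rw [pathAlong, dartSum_sup, ih hq', dartSum_edge hne, Finset.sum_range_succ]
    intro a b h
    rw [pathAlong_adj hq'] at h
    obtain ⟨t, ht, h⟩ := h
    rw [SimpleGraph.edge_adj]
    rintro ⟨h', -⟩
    have key : ∀ s ≤ n, q s ≠ q (n + 1) := fun s hs h => by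
      have := hinj s (n + 1) (by omega) le_rfl h
      omega
    have k1 := key t (by omega)
    have k2 := key (t + 1) (by omega)
    grind

end DartSum

/-! ### The twin paths as a single path through `v` -/

section Attach

variable {V : Type*}

/-- The twin paths attached at `v` as one sequence of vertices: from the end of the first path
to `v`, which has index `k₁`, and on to the end of the second path. -/
def twinPath (v : V) (k₁ k₂ : ℕ) (t : ℕ) : V ⊕ (Fin k₁ ⊕ Fin k₂) :=
  if h : t < k₁ then Sum.inr (Sum.inl ⟨k₁ - 1 - t, by omega⟩)
  else if h' : k₁ < t ∧ t ≤ k₁ + k₂ then Sum.inr (Sum.inr ⟨t - k₁ - 1, by omega⟩)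
  else Sum.inl v

/-- The index in `twinPath` of a vertex of the twin paths; it is `k₁` for all vertices of the
original graph. -/
def twinIndex (k₁ k₂ : ℕ) : V ⊕ (Fin k₁ ⊕ Fin k₂) → ℕ
  | Sum.inl _ => k₁
  | Sum.inr (Sum.inl a) => k₁ - 1 - a
  | Sum.inr (Sum.inr b) => k₁ + 1 + b

/-- The map collapsing the twin paths to `v`. -/
def collapse (v : V) (k₁ k₂ : ℕ) : V ⊕ (Fin k₁ ⊕ Fin k₂) → V :=
  Sum.elim id fun _ => v

variable (v : V) (k₁ k₂ : ℕ)

lemma twinPath_self : twinPath v k₁ k₂ k₁ = Sum.inl v := by simp [twinPath]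

lemma twinIndex_twinPath {t : ℕ} (ht : t ≤ k₁ + k₂) :
    twinIndex k₁ k₂ (twinPath v k₁ k₂ t) = t := by
  unfold twinPath
  split_ifs with h h' <;> simp only [twinIndex] <;> omega

lemma injOn_twinPath : Set.InjOn (twinPath v k₁ k₂) (Set.Iic (k₁ + k₂)) := fun s hs t ht h => by
  rw [← twinIndex_twinPath v k₁ k₂ hs, h, twinIndex_twinPath v k₁ k₂ ht]

lemma collapse_twinPath (t : ℕ) : collapse v k₁ k₂ (twinPath v k₁ k₂ t) = v := by
  unfold twinPath
  split_ifs <;> rfl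

lemma twinIndex_le (w : V ⊕ (Fin k₁ ⊕ Fin k₂)) : twinIndex k₁ k₂ w ≤ k₁ + k₂ := by
  rcases w with x | a | b <;> simp only [twinIndex] <;> omega

/-- Of the two projections of `w`, onto `G` and onto the path, one is `w` itself and the other is
`v`. -/
lemma apply_collapse_add_apply_twinPath (h : V ⊕ (Fin k₁ ⊕ Fin k₂) → ℝ)
    (w : V ⊕ (Fin k₁ ⊕ Fin k₂)) :
    h (Sum.inl (collapse v k₁ k₂ w)) + h (twinPath v k₁ k₂ (twinIndex k₁ k₂ w))
      = h (Sum.inl v) + h w := by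
  rcases w with x | a | b
  · simp [collapse, twinIndex, twinPath_self, add_comm]
  · have h1 : k₁ - 1 - (a : ℕ) < k₁ := by omega
    have h2 : k₁ - 1 - (k₁ - 1 - (a : ℕ)) = a := by omega
    simp [collapse, twinIndex, twinPath, h1, h2]
  · have h1 : ¬ k₁ + 1 + (b : ℕ) < k₁ := by omega
    have h2 : k₁ < k₁ + 1 + (b : ℕ) ∧ k₁ + 1 + (b : ℕ) ≤ k₁ + k₂ := by omega
    have h3 : k₁ + 1 + (b : ℕ) - k₁ - 1 = b := by omega
    simp [collapse, twinIndex, twinPath, h1, h2, h3]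

lemma fstPath_eq (i : Fin (k₁ + 1)) : fstPath v k₁ k₂ i = twinPath v k₁ k₂ (k₁ - i) := by
  refine Fin.cases ?_ (fun a => ?_) i
  · simp [fstPath, twinPath_self]
  · have h1 : k₁ - ((a : ℕ) + 1) < k₁ := by omega
    have h2 : k₁ - 1 - (k₁ - ((a : ℕ) + 1)) = a := by omega
    simp [fstPath, twinPath, h1, h2]

lemma sndPath_eq (i : Fin (k₂ + 1)) : sndPath v k₁ k₂ i = twinPath v k₁ k₂ (k₁ + i) := by
  refine Fin.cases ?_ (fun b => ?_) i
  · simp [sndPath, twinPath_self]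
  · have h2 : k₁ < k₁ + ((b : ℕ) + 1) ∧ k₁ + ((b : ℕ) + 1) ≤ k₁ + k₂ := by omega
    have h3 : k₁ + ((b : ℕ) + 1) - k₁ - 1 = b := by omega
    simp [sndPath, twinPath, h2]

lemma tildeGraph_eq (G : SimpleGraph V) :
    tildeGraph G v k₁ k₂ = G.map Sum.inl ⊔ pathAlong (twinPath v k₁ k₂) (k₁ + k₂) := by
  rw [tildeGraph, sup_assoc]
  congr 1
  ext a b
  rw [pathAlong_adj (injOn_twinPath v k₁ k₂), SimpleGraph.sup_adj,
    SimpleGraph.map_adj', SimpleGraph.map_adj']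
  simp only [SimpleGraph.pathGraph_adj, fstPath_eq, sndPath_eq]
  constructor
  · rintro (⟨-, i, j, h, rfl, rfl⟩ | ⟨-, i, j, h, rfl, rfl⟩)
    · rcases h with h | h
      · exact ⟨k₁ - j, by omega, Or.inr ⟨by congr 1; omega, rfl⟩⟩
      · exact ⟨k₁ - i, by omega, Or.inl ⟨rfl, by congr 1; omega⟩⟩
    · rcases h with h | h
      · exact ⟨k₁ + i, by omega, Or.inl ⟨rfl, by congr 1; omega⟩⟩
      · exact ⟨k₁ + j, by omega, Or.inr ⟨by congr 1; omega, rfl⟩⟩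
  · rintro ⟨t, ht, h⟩
    have hne : twinPath v k₁ k₂ t ≠ twinPath v k₁ k₂ (t + 1) := fun h => by
      have := injOn_twinPath v k₁ k₂ (Set.mem_Iic.2 ht.le) (Set.mem_Iic.2 ht) h
      omega
    by_cases htk : t < k₁
    · have e1 : k₁ - (k₁ - t) = t := by omega
      have e2 : k₁ - (k₁ - (t + 1)) = t + 1 := by omega
      rcases h with ⟨rfl, rfl⟩ | ⟨rfl, rfl⟩
      · exact Or.inl ⟨hne,
          ⟨k₁ - t, by omega⟩, ⟨k₁ - (t + 1), by omega⟩, Or.inr (by simp only; omega),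
          by simp only [e1], by simp only [e2]⟩
      · exact Or.inl ⟨hne.symm,
          ⟨k₁ - (t + 1), by omega⟩, ⟨k₁ - t, by omega⟩, Or.inl (by simp only; omega),
          by simp only [e2], by simp only [e1]⟩
    · have e1 : k₁ + (t - k₁) = t := by omega
      have e2 : k₁ + (t + 1 - k₁) = t + 1 := by omega
      rcases h with ⟨rfl, rfl⟩ | ⟨rfl, rfl⟩
      · exact Or.inr ⟨hne,
          ⟨t - k₁, by omega⟩, ⟨t + 1 - k₁, by omega⟩, Or.inl (by simp only; omega),
          by simp only [e1], by simp only [e2]⟩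
      · exact Or.inr ⟨hne.symm,
          ⟨t + 1 - k₁, by omega⟩, ⟨t - k₁, by omega⟩, Or.inr (by simp only; omega),
          by simp only [e2], by simp only [e1]⟩

lemma hatGraph_eq (G : SimpleGraph V) :
    hatGraph G v k₁ k₂ = tildeGraph G v k₁ k₂ ⊔
      SimpleGraph.edge (twinPath v k₁ k₂ 0) (twinPath v k₁ k₂ (k₁ + k₂)) := by
  rw [hatGraph, fstPath_eq, sndPath_eq]
  simp

lemma map_inl_not_adj_twinPath {G : SimpleGraph V} {s t : ℕ} (hs : s ≤ k₁ + k₂)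
    (ht : t ≤ k₁ + k₂) (hst : s ≠ t) :
    ¬ (G.map (Sum.inl : V → V ⊕ (Fin k₁ ⊕ Fin k₂))).Adj
      (twinPath v k₁ k₂ s) (twinPath v k₁ k₂ t) := by
  rw [SimpleGraph.map_adj']
  rintro ⟨-, x, y, -, hx, hy⟩
  have h1 := twinIndex_twinPath v k₁ k₂ hs
  have h2 := twinIndex_twinPath v k₁ k₂ ht
  rw [← hx] at h1
  rw [← hy] at h2
  exact hst (h1.symm.trans h2)

variable [Fintype V]

lemma dartSum_tildeGraph (G : SimpleGraph V) (f : V ⊕ (Fin k₁ ⊕ Fin k₂) → _ → ℝ) :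
    dartSum (tildeGraph G v k₁ k₂) f = dartSum G (fun a b => f (Sum.inl a) (Sum.inl b))
      + ∑ t ∈ Finset.range (k₁ + k₂),
        (f (twinPath v k₁ k₂ t) (twinPath v k₁ k₂ (t + 1))
          + f (twinPath v k₁ k₂ (t + 1)) (twinPath v k₁ k₂ t)) := by
  rw [tildeGraph_eq, dartSum_sup, dartSum_map_inl, dartSum_pathAlong (injOn_twinPath v k₁ k₂)]
  intro a b hab h
  rw [pathAlong_adj (injOn_twinPath v k₁ k₂)] at h
  obtain ⟨t, ht, ⟨rfl, rfl⟩ | ⟨rfl, rfl⟩⟩ := h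
  · exact map_inl_not_adj_twinPath v k₁ k₂ (by omega) (by omega) (by omega) hab
  · exact map_inl_not_adj_twinPath v k₁ k₂ (by omega) (by omega) (by omega) hab

lemma dartSum_hatGraph (G : SimpleGraph V) (hk : 2 ≤ k₁ + k₂)
    (f : V ⊕ (Fin k₁ ⊕ Fin k₂) → _ → ℝ) :
    dartSum (hatGraph G v k₁ k₂) f = dartSum (tildeGraph G v k₁ k₂) f
      + (f (twinPath v k₁ k₂ 0) (twinPath v k₁ k₂ (k₁ + k₂))
          + f (twinPath v k₁ k₂ (k₁ + k₂)) (twinPath v k₁ k₂ 0)) := by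
  have hinj : ∀ s t, s ≤ k₁ + k₂ → t ≤ k₁ + k₂ → twinPath v k₁ k₂ s = twinPath v k₁ k₂ t → s = t :=
    fun s t hs ht h => injOn_twinPath v k₁ k₂ (Set.mem_Iic.2 hs) (Set.mem_Iic.2 ht) h
  have hne : twinPath v k₁ k₂ 0 ≠ twinPath v k₁ k₂ (k₁ + k₂) := fun h => by
    have := hinj _ _ (by omega) le_rfl h
    omega
  have hnadj : ¬ (tildeGraph G v k₁ k₂).Adj (twinPath v k₁ k₂ 0) (twinPath v k₁ k₂ (k₁ + k₂)) := by
    rw [tildeGraph_eq, SimpleGraph.sup_adj, pathAlong_adj (injOn_twinPath v k₁ k₂)]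
    rintro (h | ⟨t, ht, ⟨h1, h2⟩ | ⟨h1, h2⟩⟩)
    · exact map_inl_not_adj_twinPath v k₁ k₂ (by omega) le_rfl (by omega) h
    · have := hinj _ _ (by omega) (by omega) h1
      have := hinj _ _ (by omega) (by omega) h2
      omega
    · have := hinj _ _ (by omega) (by omega) h1
      omega
  rw [hatGraph_eq, dartSum_sup, dartSum_edge hne]
  intro a b hab h
  rw [SimpleGraph.edge_adj] at h
  obtain ⟨⟨rfl, rfl⟩ | ⟨rfl, rfl⟩, -⟩ := h
  · exact hnadj hab
  · exact hnadj hab.symm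

end Attach

/-! ### Resistance sums along a path and a cycle -/

section PathSums

/-- The effective resistance between two vertices at distance `s` along a path, when its ends are
joined by a further edge: there `α = 1 / (k + 1)` for a path with `k` edges, while `α = 0` without
that edge. -/
def segmentResistance (α s : ℝ) : ℝ := |s| - α * s ^ 2

lemma segmentResistance_zero (α : ℝ) : segmentResistance α 0 = 0 := by simp [segmentResistance]

lemma segmentResistance_sub_comm (α s t : ℝ) :
    segmentResistance α (s - t) = segmentResistance α (t - s) := by
  unfold segmentResistance
  rw [abs_sub_comm]; ring

lemma sum_abs_sub_mul (h : ℕ → ℝ) {s k : ℕ} (hs : s ≤ k) :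
    ∑ t ∈ Finset.range k, (h t - h (t + 1)) * (|(t : ℝ) - s| - |((t + 1 : ℕ) : ℝ) - s|)
      = h 0 + h k - 2 * h s := by
  induction k, hs using Nat.le_induction with
  | base =>
    have : ∀ t ∈ Finset.range s,
        (h t - h (t + 1)) * (|(t : ℝ) - s| - |((t + 1 : ℕ) : ℝ) - s|) = h t - h (t + 1) := by
      intro t ht
      have h1 : ((t + 1 : ℕ) : ℝ) ≤ s := by exact_mod_cast Finset.mem_range.1 ht
      have h2 : (t : ℝ) ≤ s := le_trans (by push_cast; linarith) h1
      rw [abs_of_nonpos (by linarith), abs_of_nonpos (by linarith)]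
      push_cast; ring
    rw [Finset.sum_congr rfl this, Finset.sum_range_sub']
    ring
  | succ k hk ih =>
    have h2 : (s : ℝ) ≤ k := by exact_mod_cast hk
    rw [Finset.sum_range_succ, ih, abs_of_nonneg (by linarith),
      abs_of_nonneg (by push_cast; linarith)]
    push_cast; ring

/-- Weak Laplacian equation for the path or cycle. The quadratic part of the resistance produces a
term linear in `s`, which the closing edge cancels exactly under `hα`; then `s` enters only through
`- 2 * h s`. The condition gives `α = 0` for `ε = 0` and `α = 1 / (k + 1)` for `ε = 1`. -/
lemma sum_segmentResistance_mul (h : ℕ → ℝ) {s k : ℕ} (hs : s ≤ k) {α ε : ℝ}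
    (hα : ε * (1 - α * k) = α) :
    ∑ t ∈ Finset.range k, (h t - h (t + 1)) *
        (segmentResistance α (t - s) - segmentResistance α ((t + 1 : ℕ) - s))
      + ε * ((h 0 - h k) * (segmentResistance α ((0 : ℕ) - s) - segmentResistance α (k - s)))
      = h 0 + h k + α * ∑ t ∈ Finset.range k, (2 * t + 1) * (h t - h (t + 1))
        + ε * (α * k - 1) * k * (h 0 - h k) - 2 * h s := by
  have h1 : ∀ t : ℕ, (h t - h (t + 1)) *
        (segmentResistance α (t - s) - segmentResistance α ((t + 1 : ℕ) - s))
      = (h t - h (t + 1)) * (|(t : ℝ) - s| - |((t + 1 : ℕ) : ℝ) - s|)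
        + (α * ((2 * t + 1) * (h t - h (t + 1))) - 2 * α * s * (h t - h (t + 1))) := by
    intro t
    simp only [segmentResistance]
    push_cast; ring
  simp only [h1, Finset.sum_add_distrib, Finset.sum_sub_distrib, ← Finset.mul_sum]
  rw [sum_abs_sub_mul h hs]
  have htel : ∑ t ∈ Finset.range k, h t - ∑ t ∈ Finset.range k, h (t + 1) = h 0 - h k := by
    rw [← Finset.sum_sub_distrib, Finset.sum_range_sub']
  rw [htel]
  have hs' : (s : ℝ) ≤ k := by exact_mod_cast hs
  have hs0 : (0 : ℝ) ≤ s := s.cast_nonneg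
  simp only [segmentResistance]
  rw [Nat.cast_zero, abs_of_nonpos (by linarith : (0 : ℝ) - s ≤ 0),
    abs_of_nonneg (by linarith : (0 : ℝ) ≤ k - s)]
  linear_combination (2 * (s : ℝ) * (h 0 - h k)) * hα

/-- The sum of `f a + f b` over the edges `{a, b}` of the path `0, …, k` and, with weight `ε`, the
edge joining its ends. -/
def edgeEndSum (ε : ℝ) (k : ℕ) (f : ℕ → ℝ) : ℝ :=
  ∑ t ∈ Finset.range k, (f t + f (t + 1)) + ε * (f 0 + f k)

variable (ε : ℝ) (k : ℕ)

lemma edgeEndSum_const (c : ℝ) : edgeEndSum ε k (fun _ => c) = 2 * (k + ε) * c := by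
  simp [edgeEndSum]; ring

lemma edgeEndSum_add (f g : ℕ → ℝ) :
    edgeEndSum ε k (fun t => f t + g t) = edgeEndSum ε k f + edgeEndSum ε k g := by
  simp only [edgeEndSum, Finset.sum_add_distrib]; ring

lemma edgeEndSum_mul_left (c : ℝ) (f : ℕ → ℝ) :
    edgeEndSum ε k (fun t => c * f t) = c * edgeEndSum ε k f := by
  simp only [edgeEndSum, mul_add, Finset.mul_sum, Finset.sum_add_distrib]; ring

lemma edgeEndSum_congr {f g : ℕ → ℝ} (h : ∀ t ≤ k, f t = g t) :
    edgeEndSum ε k f = edgeEndSum ε k g := by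
  unfold edgeEndSum
  rw [h 0 k.zero_le, h k le_rfl]
  congr 1
  refine Finset.sum_congr rfl fun t ht => ?_
  have := Finset.mem_range.1 ht
  rw [h t (by omega), h (t + 1) (by omega)]

lemma sum_abs_sub_add (k₁ k₂ : ℕ) :
    ∑ t ∈ Finset.range (k₁ + k₂), (|(t : ℝ) - k₁| + |((t + 1 : ℕ) : ℝ) - k₁|)
      = (k₁ : ℝ) ^ 2 + (k₂ : ℝ) ^ 2 := by
  induction k₂ with
  | zero =>
    have h : ∀ n : ℕ, n ≤ k₁ →
        ∑ t ∈ Finset.range n, (|(t : ℝ) - k₁| + |((t + 1 : ℕ) : ℝ) - k₁|)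
          = 2 * k₁ * n - (n : ℝ) ^ 2 := by
      intro n
      induction n with
      | zero => simp
      | succ n ih =>
        intro hn
        have hn' : ((n + 1 : ℕ) : ℝ) ≤ k₁ := by exact_mod_cast hn
        rw [Finset.sum_range_succ, ih (by omega), abs_of_nonpos (by push_cast at hn'; linarith),
          abs_of_nonpos (by linarith)]
        push_cast; ring
    rw [add_zero, h k₁ le_rfl]
    push_cast; ring
  | succ n ih =>
    rw [← add_assoc, Finset.sum_range_succ, ih,
      abs_of_nonneg (by push_cast; linarith [(Nat.cast_nonneg n : (0 : ℝ) ≤ n)]),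
      abs_of_nonneg (by push_cast; linarith [(Nat.cast_nonneg n : (0 : ℝ) ≤ n)])]
    push_cast; ring

lemma sum_sq_sub_add (a : ℝ) :
    ∑ t ∈ Finset.range k, (((t : ℝ) - a) ^ 2 + (((t + 1 : ℕ) : ℝ) - a) ^ 2)
      = k * (2 * (k : ℝ) ^ 2 + 1) / 3 - 2 * a * (k : ℝ) ^ 2 + 2 * a ^ 2 * k := by
  induction k with
  | zero => simp
  | succ k ih =>
    rw [Finset.sum_range_succ, ih]
    push_cast; ring

lemma edgeEndSum_path (k₁ k₂ : ℕ) :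
    edgeEndSum 0 (k₁ + k₂) (fun t => segmentResistance 0 (t - k₁))
      = (k₁ : ℝ) ^ 2 + (k₂ : ℝ) ^ 2 := by
  simp only [edgeEndSum, segmentResistance, zero_mul, sub_zero, add_zero]
  exact sum_abs_sub_add k₁ k₂

lemma edgeEndSum_cycle (k₁ k₂ : ℕ) :
    edgeEndSum 1 (k₁ + k₂)
        (fun t => segmentResistance (1 / ((k₁ + k₂ : ℕ) + 1)) (t - k₁))
      = (((k₁ + k₂ : ℕ) : ℝ) ^ 2 + 2 * ((k₁ + k₂ : ℕ) : ℝ)) / 3 := by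
  set α : ℝ := 1 / ((k₁ + k₂ : ℕ) + 1) with hα
  have h1 : ∀ t : ℕ, segmentResistance α (t - k₁) + segmentResistance α ((t + 1 : ℕ) - k₁)
      = (|(t : ℝ) - k₁| + |((t + 1 : ℕ) : ℝ) - k₁|)
        - α * (((t : ℝ) - k₁) ^ 2 + (((t + 1 : ℕ) : ℝ) - k₁) ^ 2) := by
    intro t; simp only [segmentResistance]; ring
  have hk₁ : (0 : ℝ) ≤ k₁ := k₁.cast_nonneg
  have hk₂ : (0 : ℝ) ≤ k₂ := k₂.cast_nonneg
  simp only [edgeEndSum, h1, Finset.sum_sub_distrib, ← Finset.mul_sum]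
  rw [sum_abs_sub_add, sum_sq_sub_add]
  simp only [segmentResistance]
  rw [abs_of_nonpos (by simp), abs_of_nonneg (by push_cast; linarith), hα]
  push_cast
  have : (k₁ : ℝ) + k₂ + 1 ≠ 0 := by positivity
  field_simp
  ring

end PathSums

/-! ### Gluing resistances at the cut vertex -/

section Gluing

variable {V : Type*} [Fintype V] {G : SimpleGraph V} {R : V → V → ℝ} {v : V} {k₁ k₂ : ℕ}

/-- `H` consists of the graph `G`, the twin paths attached at `v` and, with multiplicity `ε`, the
edge joining their ends. -/
def IsTwinExtension (G : SimpleGraph V) (v : V) (k₁ k₂ : ℕ) (ε : ℝ)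
    (H : SimpleGraph (V ⊕ (Fin k₁ ⊕ Fin k₂))) : Prop :=
  ∀ f : V ⊕ (Fin k₁ ⊕ Fin k₂) → V ⊕ (Fin k₁ ⊕ Fin k₂) → ℝ,
    dartSum H f = dartSum G (fun a b => f (Sum.inl a) (Sum.inl b))
      + ∑ t ∈ Finset.range (k₁ + k₂),
        (f (twinPath v k₁ k₂ t) (twinPath v k₁ k₂ (t + 1))
          + f (twinPath v k₁ k₂ (t + 1)) (twinPath v k₁ k₂ t))
      + ε * (f (twinPath v k₁ k₂ 0) (twinPath v k₁ k₂ (k₁ + k₂))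
          + f (twinPath v k₁ k₂ (k₁ + k₂)) (twinPath v k₁ k₂ 0))

lemma isTwinExtension_tildeGraph (G : SimpleGraph V) (v : V) (k₁ k₂ : ℕ) :
    IsTwinExtension G v k₁ k₂ 0 (tildeGraph G v k₁ k₂) := fun f => by
  rw [dartSum_tildeGraph, zero_mul, add_zero]

lemma isTwinExtension_hatGraph (G : SimpleGraph V) (v : V) (hk : 2 ≤ k₁ + k₂) :
    IsTwinExtension G v k₁ k₂ 1 (hatGraph G v k₁ k₂) := fun f => by
  rw [dartSum_hatGraph v k₁ k₂ G hk, dartSum_tildeGraph, one_mul]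

/-- The effective resistances of a graph with attached twin paths. -/
def twinResistance (R : V → V → ℝ) (v : V) (k₁ k₂ : ℕ) (α : ℝ)
    (a b : V ⊕ (Fin k₁ ⊕ Fin k₂)) : ℝ :=
  R (collapse v k₁ k₂ a) (collapse v k₁ k₂ b)
    + segmentResistance α ((twinIndex k₁ k₂ a : ℝ) - twinIndex k₁ k₂ b)

variable {α ε : ℝ} {H : SimpleGraph (V ⊕ (Fin k₁ ⊕ Fin k₂))}

lemma IsTwinExtension.isResistanceMatrix (hH : IsTwinExtension G v k₁ k₂ ε H)
    (hR : IsResistanceMatrix G R) (hα : ε * (1 - α * (k₁ + k₂ : ℕ)) = α) :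
    IsResistanceMatrix H (twinResistance R v k₁ k₂ α) := by
  classical
  obtain ⟨u, hu⟩ := hR.laplacian
  set q := twinPath v k₁ k₂ with hq
  refine isResistanceMatrix_of_dartSum
    (fun a b => by rw [twinResistance, twinResistance, hR.symm, segmentResistance_sub_comm])
    (fun a => by rw [twinResistance, hR.diag, sub_self, segmentResistance_zero, add_zero])
    (fun h => ∑ a, h (Sum.inl a) * u a + (h (q 0) + h (q (k₁ + k₂))
      + α * ∑ t ∈ Finset.range (k₁ + k₂), (2 * t + 1) * (h (q t) - h (q (t + 1)))
      + ε * (α * (k₁ + k₂ : ℕ) - 1) * (k₁ + k₂ : ℕ) * (h (q 0) - h (q (k₁ + k₂))))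
      - 2 * h (Sum.inl v)) (fun h j => ?_)
  have hG : dartSum G (fun a b => h (Sum.inl a) *
      (twinResistance R v k₁ k₂ α (Sum.inl a) j - twinResistance R v k₁ k₂ α (Sum.inl b) j))
      = ∑ a, h (Sum.inl a) * u a - 2 * h (Sum.inl (collapse v k₁ k₂ j)) := by
    rw [← dartSum_laplacian (fun i => hu i (collapse v k₁ k₂ j)) (fun a => h (Sum.inl a))]
    simp [twinResistance, collapse, twinIndex]
  have hpath : ∀ s t, s ≤ k₁ + k₂ → t ≤ k₁ + k₂ →
      h (q s) * (twinResistance R v k₁ k₂ α (q s) j - twinResistance R v k₁ k₂ α (q t) j)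
        + h (q t) * (twinResistance R v k₁ k₂ α (q t) j - twinResistance R v k₁ k₂ α (q s) j)
      = (h (q s) - h (q t)) * (segmentResistance α (s - twinIndex k₁ k₂ j)
          - segmentResistance α (t - twinIndex k₁ k₂ j)) := by
    intro s t hs ht
    simp only [twinResistance, hq, collapse_twinPath, twinIndex_twinPath v k₁ k₂ hs,
      twinIndex_twinPath v k₁ k₂ ht]
    ring
  have hsum := sum_segmentResistance_mul (fun t => h (q t)) (twinIndex_le k₁ k₂ j) hα
  -- The pieces contribute point masses at the two projections of `j`; together these are the point
  -- mass at `j` and one at `v`, and the latter is independent of `j`.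
  have hsplit := apply_collapse_add_apply_twinPath v k₁ k₂ h j
  rw [hH, hG, hpath 0 (k₁ + k₂) (Nat.zero_le _) le_rfl, Finset.sum_congr rfl fun t ht =>
    hpath t (t + 1) (Finset.mem_range.1 ht).le (Finset.mem_range.1 ht)]
  rw [← hq] at hsplit
  linarith

lemma IsTwinExtension.sum_degVec_mul (hH : IsTwinExtension G v k₁ k₂ ε H)
    (f : V ⊕ (Fin k₁ ⊕ Fin k₂) → ℝ) :
    ∑ a, degVec H a * f a = ∑ a, degVec G a * f (Sum.inl a)
      + edgeEndSum ε (k₁ + k₂) (fun t => f (twinPath v k₁ k₂ t)) := by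
  rw [← dartSum_fst, hH, ← dartSum_fst, edgeEndSum, add_assoc]

lemma IsTwinExtension.numEdges_eq (hH : IsTwinExtension G v k₁ k₂ ε H) :
    (numEdges H : ℝ) = numEdges G + ((k₁ + k₂ : ℕ) + ε) := by
  have h := hH.sum_degVec_mul (fun _ => 1)
  simp only [mul_one] at h
  rw [sum_degVec, sum_degVec, edgeEndSum_const] at h
  linarith

/-- Resistances add across `v`, so each mixed term is weighted by the total degree of the other
piece: `2 (k + ε)` for the attached part, `2 m` for `G`. Each mixed term occurs twice. -/
lemma IsTwinExtension.degForm_eq (hH : IsTwinExtension G v k₁ k₂ ε H)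
    (hR : ∀ i j, R i j = R j i) (hv : R v v = 0) :
    degForm H (twinResistance R v k₁ k₂ α) = degForm G R
      + 4 * ((k₁ + k₂ : ℕ) + ε) * ∑ a, degVec G a * R a v
      + 4 * numEdges G * edgeEndSum ε (k₁ + k₂) (fun t => segmentResistance α (t - k₁))
      + edgeEndSum ε (k₁ + k₂) (fun s => edgeEndSum ε (k₁ + k₂)
          (fun t => segmentResistance α (s - t))) := by
  set k := k₁ + k₂ with hk
  set B := edgeEndSum ε k (fun t => segmentResistance α (t - k₁)) with hB
  have hdf : ∀ {U : Type _} [Fintype U] (K : SimpleGraph U) (Q : U → U → ℝ),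
      degForm K Q = ∑ a, degVec K a * ∑ b, degVec K b * Q a b := by
    intro U _ K Q
    simp only [degForm, Finset.mul_sum, mul_assoc]
  have hinl : ∀ a : V, ∑ b, degVec H b * twinResistance R v k₁ k₂ α (Sum.inl a) b
      = ∑ b, degVec G b * R a b + (2 * (k + ε) * R a v + B) := by
    intro a
    rw [hH.sum_degVec_mul]
    congr 1
    · simp [twinResistance, collapse, twinIndex, segmentResistance_zero]
    · rw [edgeEndSum_congr ε _ (g := fun t => R a v + segmentResistance α (t - k₁))
        fun t ht => ?_, edgeEndSum_add, edgeEndSum_const]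
      rw [twinResistance, collapse_twinPath, twinIndex_twinPath v k₁ k₂ ht,
        segmentResistance_sub_comm]
      rfl
  have hpath : ∀ s ≤ k, ∑ b, degVec H b * twinResistance R v k₁ k₂ α (twinPath v k₁ k₂ s) b
      = ∑ b, degVec G b * R b v + 2 * numEdges G * segmentResistance α (s - k₁)
        + edgeEndSum ε k (fun t => segmentResistance α (s - t)) := by
    intro s hs
    rw [hH.sum_degVec_mul]
    congr 1
    · rw [← sum_degVec, Finset.sum_mul, ← Finset.sum_add_distrib]
      refine Finset.sum_congr rfl fun b _ => ?_
      rw [twinResistance, collapse_twinPath, twinIndex_twinPath v k₁ k₂ hs, hR v, mul_add]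
      rfl
    · refine edgeEndSum_congr ε _ fun t ht => ?_
      rw [twinResistance, collapse_twinPath, collapse_twinPath, twinIndex_twinPath v k₁ k₂ hs,
        twinIndex_twinPath v k₁ k₂ ht, hv, zero_add]
  rw [hdf, hH.sum_degVec_mul, edgeEndSum_congr ε _ hpath, edgeEndSum_add, edgeEndSum_add,
    edgeEndSum_const, edgeEndSum_mul_left, hdf]
  have hlin : ∑ a, degVec G a * (∑ b, degVec G b * R a b + (2 * (k + ε) * R a v + B))
      = ∑ a, degVec G a * ∑ b, degVec G b * R a b
        + (2 * (k + ε) * ∑ a, degVec G a * R a v + (∑ a, degVec G a) * B) := by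
    rw [Finset.mul_sum, Finset.sum_mul, ← Finset.sum_add_distrib, ← Finset.sum_add_distrib]
    exact Finset.sum_congr rfl fun a _ => by ring
  simp only [hinl]
  rw [hlin, sum_degVec]
  ring

lemma phi_eq (G : SimpleGraph V) (v : V) :
    phi G v = 4 * numEdges G * ∑ a, degVec G a * forestMatrix G a v
      - degForm G (forestMatrix G) := by
  have h : ∀ i, ∑ j, ((2 : ℝ) * (forestMatrix G i v * 1) - forestMatrix G i j) * degVec G j
      = 4 * numEdges G * forestMatrix G i v - ∑ j, degVec G j * forestMatrix G i j := by
    intro i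
    simp only [sub_mul, Finset.sum_sub_distrib, ← Finset.mul_sum]
    rw [sum_degVec]
    congr 1
    · ring
    · exact Finset.sum_congr rfl fun j _ => mul_comm _ _
  simp only [phi, dotProduct, Matrix.mulVec, Matrix.sub_apply, Matrix.smul_apply,
    Matrix.vecMulVec_apply, smul_eq_mul, h, degForm, mul_sub, Finset.sum_sub_distrib,
    Finset.mul_sum, mul_assoc]
  congr 1
  exact Finset.sum_congr rfl fun i _ => by ring

end Gluing

/-! ### The threshold and its limit -/

section Asymptotics

open Topology

/-- The contribution of the twin paths, with their ends joined (`ε = 1`) or not (`ε = 0`), to the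
numerator of Kemeny's constant. -/
def twinSelfTerm (ε : ℝ) (k : ℕ) (α : ℝ) : ℝ :=
  edgeEndSum ε k fun s => edgeEndSum ε k fun t => segmentResistance α (s - t)

/-- The value that `φ / (4 m² τ)` has to exceed in order that a graph with `m` edges be
`(v, k₁, k₂)`-paradoxical. -/
noncomputable def paradoxThreshold (k₁ k₂ : ℕ) (m : ℝ) : ℝ :=
  ((m + (k₁ + k₂ : ℕ) + 1) *
      (twinSelfTerm 0 (k₁ + k₂) 0 + 4 * m * ((k₁ : ℝ) ^ 2 + (k₂ : ℝ) ^ 2))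
    - (m + (k₁ + k₂ : ℕ)) * (twinSelfTerm 1 (k₁ + k₂) (1 / ((k₁ + k₂ : ℕ) + 1))
      + 4 * m * ((((k₁ + k₂ : ℕ) : ℝ) ^ 2 + 2 * ((k₁ + k₂ : ℕ) : ℝ)) / 3))) / (4 * m ^ 2)

lemma tendsto_paradoxThreshold (k₁ k₂ : ℕ) :
    Tendsto (paradoxThreshold k₁ k₂) atTop (𝓝 ((k₁ : ℝ) ^ 2 + (k₂ : ℝ) ^ 2
      - (((k₁ + k₂ : ℕ) : ℝ) ^ 2 + 2 * ((k₁ + k₂ : ℕ) : ℝ)) / 3)) := by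
  set k : ℝ := ((k₁ + k₂ : ℕ) : ℝ) with hk
  set X := twinSelfTerm 0 (k₁ + k₂) 0 with hX
  set X' := twinSelfTerm 1 (k₁ + k₂) (1 / (k + 1)) with hX'
  set Y : ℝ := (k₁ : ℝ) ^ 2 + (k₂ : ℝ) ^ 2 with hY
  set Y' : ℝ := (k ^ 2 + 2 * k) / 3 with hY'
  have h0 : Tendsto (fun m : ℝ => m⁻¹) atTop (𝓝 0) := tendsto_inv_atTop_zero
  -- The exact expansion of the threshold in powers of `1 / m`.
  have h1 := (tendsto_const_nhds (x := Y - Y') (f := (atTop : Filter ℝ))).add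
    ((h0.const_mul ((X - X') / 4 + (k + 1) * Y - k * Y')).add
      ((h0.mul h0).const_mul (((k + 1) * X - k * X') / 4)))
  simp only [mul_zero, add_zero] at h1
  refine h1.congr' ?_
  filter_upwards [eventually_gt_atTop 0] with m hm
  rw [paradoxThreshold]
  simp only [← hk, ← hX, ← hX', ← hY, ← hY']
  field_simp
  ring

variable {V : Type*} [Fintype V] {G : SimpleGraph V}

/-- The threshold criterion for Braess' paradox with twin pendent paths. -/
theorem isParadoxical_iff (hG : G.Connected) (hm : 0 < numEdges G) (v : V) {k₁ k₂ : ℕ}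
    (hk : 2 ≤ k₁ + k₂) :
    IsParadoxical G v k₁ k₂ ↔ paradoxThreshold k₁ k₂ (numEdges G) <
      phi G v / (4 * (numEdges G : ℝ) ^ 2 * numSpanningTrees G) := by
  have : Nontrivial (V ⊕ (Fin k₁ ⊕ Fin k₂)) := by
    refine ⟨twinPath v k₁ k₂ 0, twinPath v k₁ k₂ (k₁ + k₂), fun h => ?_⟩
    have := injOn_twinPath v k₁ k₂ (Set.mem_Iic.2 (Nat.zero_le _)) (Set.mem_Iic.2 le_rfl) h
    omega
  have hR := isResistanceMatrix_forestMatrix_div hG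
  set R : V → V → ℝ := fun i j => forestMatrix G i j / numSpanningTrees G with hRdef
  have hkpos : (0 : ℝ) < (k₁ + k₂ : ℕ) + 1 := by positivity
  have ht := isTwinExtension_tildeGraph G v k₁ k₂
  have hh := isTwinExtension_hatGraph G v hk
  have hRt := ht.isResistanceMatrix hR (α := 0) (by ring)
  have hRh := hh.isResistanceMatrix hR (α := 1 / ((k₁ + k₂ : ℕ) + 1)) (by
    have := hkpos.ne'
    field_simp
    ring)
  have hm' : (0 : ℝ) < numEdges G := by exact_mod_cast hm
  have hτ : (0 : ℝ) < numSpanningTrees G := by exact_mod_cast numSpanningTrees_pos hG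
  have hphi : phi G v / (4 * (numEdges G : ℝ) ^ 2 * numSpanningTrees G)
      = (4 * numEdges G * ∑ a, degVec G a * R a v - degForm G R) / (4 * (numEdges G : ℝ) ^ 2) := by
    have h1 : ∑ a, degVec G a * R a v
        = (∑ a, degVec G a * forestMatrix G a v) / numSpanningTrees G := by
      rw [Finset.sum_div]
      exact Finset.sum_congr rfl fun a _ => by simp only [hRdef]; ring
    have h2 : degForm G R = degForm G (forestMatrix G) / numSpanningTrees G := by
      simp only [degForm, hRdef, Finset.sum_div]
      exact Finset.sum_congr rfl fun a _ => Finset.sum_congr rfl fun b _ => by ring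
    rw [phi_eq, h1, h2]
    field_simp
  have hiff : IsParadoxical G v k₁ k₂ ↔
      degForm (tildeGraph G v k₁ k₂) (twinResistance R v k₁ k₂ 0)
          / (4 * numEdges (tildeGraph G v k₁ k₂))
        < degForm (hatGraph G v k₁ k₂) (twinResistance R v k₁ k₂ (1 / ((k₁ + k₂ : ℕ) + 1)))
          / (4 * numEdges (hatGraph G v k₁ k₂)) := by
    simp only [IsParadoxical, hRt.isKemenyConstant_iff, hRh.isKemenyConstant_iff]
    constructor
    · rintro ⟨K, K', rfl, rfl, h⟩
      exact h
    · exact fun h => ⟨_, _, rfl, rfl, h⟩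
  -- After cross-multiplication, the coefficient of `dᵀ R d` is `(m + k) - (m + k + 1) = -1` and
  -- that of `4 ∑ d_a R_{a,v}` is `(m + k)(k + 1) - (m + k + 1) k = m`.
  rw [hiff, hphi, ht.degForm_eq hR.symm (hR.diag v), hh.degForm_eq hR.symm (hR.diag v),
    ht.numEdges_eq, hh.numEdges_eq, edgeEndSum_path, edgeEndSum_cycle, paradoxThreshold,
    div_lt_div_iff_of_pos_right (by positivity), div_lt_div_iff₀ (by positivity) (by positivity),
    ← sub_pos, ← sub_pos (a := 4 * _ * _ - _)]
  simp only [← twinSelfTerm.eq_1]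
  constructor <;> intro h <;> nlinarith only [h]

lemma card_le_numEdges_add_one (hG : G.Connected) : Fintype.card V ≤ numEdges G + 1 := by
  classical
  have h := hG.card_vert_le_card_edgeSet_add_one
  rw [Nat.card_eq_fintype_card, Nat.card_eq_fintype_card, SimpleGraph.card_edgeSet] at h
  convert h using 2
  simp only [numEdges]

end Asymptotics

theorem isAsympParadoxical_iff_tendsto {V : ℕ+ → Type*} [∀ n, Fintype (V n)]
    (G : ∀ n, SimpleGraph (V n)) (v : ∀ n, V n)
    (hconn : ∀ n, (G n).Connected) (hcard : ∀ n, Fintype.card (V n) = (n : ℕ)) :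
    IsAsympParadoxical G v ↔
      Tendsto (fun n : ℕ+ => phi (G n) (v n) /
        (4 * (numEdges (G n) : ℝ) ^ 2 * (numSpanningTrees (G n) : ℝ)))
        atTop atTop := by
  have hedges : Tendsto (fun n : ℕ+ => (numEdges (G n) : ℝ)) atTop atTop := by
    refine tendsto_natCast_atTop_atTop.comp (tendsto_atTop.2 fun b => ?_)
    filter_upwards [eventually_ge_atTop (Nat.succPNat b)] with n hn
    have h1 := card_le_numEdges_add_one (hconn n)
    rw [hcard] at h1
    have h2 : b + 1 ≤ (n : ℕ) := by exact_mod_cast hn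
    omega
  have hiff : ∀ k₁ k₂, 2 ≤ k₁ + k₂ → (IsAsympParadoxicalAt G v k₁ k₂ ↔
      ∀ᶠ n in atTop, paradoxThreshold k₁ k₂ (numEdges (G n)) <
        phi (G n) (v n) / (4 * (numEdges (G n) : ℝ) ^ 2 * numSpanningTrees (G n))) := by
    intro k₁ k₂ hk
    rw [IsAsympParadoxicalAt, ← eventually_atTop]
    refine eventually_congr ?_
    -- This discards the one-vertex graph, where the ratio has denominator zero.
    filter_upwards [hedges.eventually_gt_atTop 0] with n hn
    exact isParadoxical_iff (hconn n) (by exact_mod_cast hn) (v n) hk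
  have hlim := fun k₁ k₂ => (tendsto_paradoxThreshold k₁ k₂).comp hedges
  constructor
  · intro h
    refine tendsto_atTop.2 fun b => ?_
    -- With all new edges on one path the limiting threshold is `(2 k² - 2 k) / 3`, which exceeds
    -- `k`, hence `b`, once `k > 4`.
    obtain ⟨k, hk⟩ := exists_nat_gt (max b 4)
    have hk4 : (4 : ℝ) < k := (le_max_right _ _).trans_lt hk
    have hkb : b < k := (le_max_left _ _).trans_lt hk
    have hk2 : 2 ≤ k + 0 := by
      have : 4 < k := by exact_mod_cast hk4
      omega
    have hb : b < (k : ℝ) ^ 2 + ((0 : ℕ) : ℝ) ^ 2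
        - (((k + 0 : ℕ) : ℝ) ^ 2 + 2 * ((k + 0 : ℕ) : ℝ)) / 3 := by
      push_cast
      nlinarith
    filter_upwards [(hiff k 0 hk2).1 (h k 0 hk2), (hlim k 0).eventually_const_lt hb] with n h1 h2
    exact h2.le.trans h1.le
  · intro h k₁ k₂ hk
    rw [hiff k₁ k₂ hk]
    filter_upwards [(hlim k₁ k₂).eventually_lt_const (lt_add_one _),
      h.eventually_gt_atTop _] with n h1 h2
    exact lt_trans h1 h2

end TwinPaths

theorem theorem4p1 {V : ℕ+ → Type*} [∀ n, Fintype (V n)]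
    (G : ∀ n, SimpleGraph (V n)) (v : ∀ n, V n)
    (hconn : ∀ n, (G n).Connected) (hcard : ∀ n, Fintype.card (V n) = (n : ℕ)) :
    TwinPaths.IsAsympParadoxical G v ↔
      Tendsto (fun n : ℕ+ => TwinPaths.phi (G n) (v n) /
        (4 * (TwinPaths.numEdges (G n) : ℝ) ^ 2 * (TwinPaths.numSpanningTrees (G n) : ℝ)))
        atTop atTop :=
  TwinPaths.isAsympParadoxical_iff_tendsto G v hconn hcard
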